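/- Let $n\ge 2$, $0<\lambda\le\Lambda$ and $p,q>0$, and let $\mathbb R^n_+=\{x\in\mathbb R^n: x_n>0\}$. For a real symmetric $n\times n$ matrix $M$ with eigenvalues $e_1,\dots,e_n$ (counted with multiplicity) put $$\mathcal M^-_{\lambda,\Lambda}(M)=\lambda\sum_{e_i>0}e_i+\Lambda\sum_{e_i<0}e_i .$$ A nonnegative supersolution of the system $$\mathcal M^-_{\lambda,\Lambda}(D^2u)+v^p=0,\qquad \mathcal M^-_{\lambda,\Lambda}(D^2v)+u^q=0\qquad\text{in }\mathbb R^n_+ \tag{S}$$ is a pair of continuous functions $u,v:\mathbb R^n_+\to[0,\infty)$ that satisfies both inequalities $\mathcal M^-_{\lambda,\Lambda}(D^2u)+v^p\le 0$ and $\mathcal M^-_{\lambda,\Lambda}(D^2v)+u^q\le 0$ in the viscosity sense: whenever $x_0\in\mathbb R^n_+$, $\varphi\in C^2(\mathbb R^n_+)$ and $u-\varphi$ (respectively $v-\varphi$) has a local minimum at $x_0$, then $\mathcal M^-_{\lambda,\Lambda}(D^2\varphi(x_0))+v(x_0)^p\le 0$ (respectively $\mathcal M^-_{\lambda,\Lambda}(D^2\varphi(x_0))+u(x_0)^q\le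 0$). No boundary condition is imposed. Then $u\equiv v\equiv 0$ is the only nonnegative supersolution of (S) in each of the following cases: 1. $pq>1$, and $\dfrac{2(p+1)}{pq-1}>\dfrac{\Lambda n}{\lambda}-1$ or $\dfrac{2(q+1)}{pq-1}>\dfrac{\Lambda n}{\lambda}-1$; 2. $\dfrac{2(p+1)}{pq-1}=\dfrac{\Lambda n}{\lambda}-1$ and $\dfrac{2(q+1)}{pq-1}=\dfrac{\Lambda n}{\lambda}-1$; 3. $pq=1$. -/

import Mathlib

/-- The open half space of points of `ℝⁿ` whose last coordinate `xₙ` is positive (`1 ≤ n`). -/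
def upperHalfSpace (n : ℕ) : Set (EuclideanSpace ℝ (Fin n)) :=
  {x | ∀ i : Fin n, (i : ℕ) + 1 = n → 0 < x i}

/-- The Hessian matrix `D²φ(x)`, with entries the second partial derivatives `∂ᵢ∂ⱼφ(x)`. -/
noncomputable def hessian {n : ℕ} (φ : EuclideanSpace ℝ (Fin n) → ℝ)
    (x : EuclideanSpace ℝ (Fin n)) : Matrix (Fin n) (Fin n) ℝ :=
  Matrix.of fun i j =>
    fderiv ℝ (fderiv ℝ φ) x (EuclideanSpace.single i 1) (EuclideanSpace.single j 1)

/-- Pucci's inf-operator `M⁻(M) = lam * ∑_{e > 0} e + Lam * ∑_{e < 0} e`, where `e` runs over the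
eigenvalues of the symmetric matrix `M`, counted with multiplicity, that is, over the roots of
its characteristic polynomial. -/
noncomputable def pucciInf {n : ℕ} (lam Lam : ℝ) (M : Matrix (Fin n) (Fin n) ℝ) : ℝ :=
  lam * (M.charpoly.roots.filter (fun e => 0 < e)).sum
    + Lam * (M.charpoly.roots.filter (fun e => e < 0)).sum

/-- For a symmetric matrix, `pucciInf` is the weighted sum over Mathlib's eigenvalue family. -/
theorem pucciInf_eq_sum_eigenvalues {n : ℕ} (lam Lam : ℝ) {M : Matrix (Fin n) (Fin n) ℝ}
    (hM : M.IsHermitian) :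
    pucciInf lam Lam M =
      lam * (∑ i with 0 < hM.eigenvalues i, hM.eigenvalues i)
        + Lam * (∑ i with hM.eigenvalues i < 0, hM.eigenvalues i) := by
  have h : M.charpoly.roots = Multiset.map hM.eigenvalues Finset.univ.val := by
    simpa using hM.roots_charpoly_eq_eigenvalues
  simp only [pucciInf, h, Multiset.filter_map, Finset.sum, Finset.filter_val]
  rfl

/-- The Hessian of a function that is `C²` on an open set is symmetric there. -/
theorem hessian_isHermitian {n : ℕ} {φ : EuclideanSpace ℝ (Fin n) → ℝ}
    {Ω : Set (EuclideanSpace ℝ (Fin n))} (hΩ : IsOpen Ω) (hφ : ContDiffOn ℝ 2 φ Ω)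
    {x : EuclideanSpace ℝ (Fin n)} (hx : x ∈ Ω) : (hessian φ x).IsHermitian := by
  have h := (hφ.contDiffAt (hΩ.mem_nhds hx)).isSymmSndFDerivAt (by simp)
  ext i j
  simpa [hessian] using h.eq _ _

/-- `u` is a viscosity supersolution of `F(x, D²u) = 0` in the open set `Ω`: it is continuous
in `Ω`, and `F(x₀, D²φ(x₀)) ≤ 0` whenever `x₀ ∈ Ω`, `φ ∈ C²(Ω)` and `u - φ` has a local minimum
at `x₀`. Only the values of `u` in `Ω` matter. -/
def IsViscositySupersolution {n : ℕ}
    (F : EuclideanSpace ℝ (Fin n) → Matrix (Fin n) (Fin n) ℝ → ℝ)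
    (Ω : Set (EuclideanSpace ℝ (Fin n))) (u : EuclideanSpace ℝ (Fin n) → ℝ) : Prop :=
  ContinuousOn u Ω ∧
    ∀ x₀ ∈ Ω, ∀ φ : EuclideanSpace ℝ (Fin n) → ℝ, ContDiffOn ℝ 2 φ Ω →
      IsLocalMinOn (fun x => u x - φ x) Ω x₀ → F x₀ (hessian φ x₀) ≤ 0

/-- `(u, v)` is a nonnegative viscosity supersolution of the system
`M⁻(D²u) + v ^ p = 0`, `M⁻(D²v) + u ^ q = 0` in the upper half space. -/
def IsNonnegSystemSupersolution (n : ℕ) (lam Lam p q : ℝ)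
    (u v : EuclideanSpace ℝ (Fin n) → ℝ) : Prop :=
  (∀ x ∈ upperHalfSpace n, 0 ≤ u x) ∧ (∀ x ∈ upperHalfSpace n, 0 ≤ v x) ∧
    IsViscositySupersolution (fun x M => pucciInf lam Lam M + v x ^ p) (upperHalfSpace n) u ∧
    IsViscositySupersolution (fun x M => pucciInf lam Lam M + u x ^ q) (upperHalfSpace n) v

/-! The proof plays an upper bound for positive supersolutions, coming from the scaling of the
system, against a lower bound that any positive supersolution of one inequality satisfies. By the
strong minimum principle (`IsViscositySupersolution.eq_zero_or_pos`) each component is either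
identically zero or positive. If one vanishes, so does its source term, hence the other component;
so both may be taken positive.

Upper bound (`exists_log_upper_bound`). On a ball of radius `R/8` centred at height `2R`, touching
by paraboloids, together with a radial barrier, gives `(min v)^p ≤ K (min u) / R²` and the same with
`u, v` and `p, q` exchanged. Eliminating `min v` gives `(min u)^(pq-1) ≤ K R^(-2(p+1))`.

Lower bound (`IsViscositySupersolution.exists_mul_exp_le`). Let `γ = Λn/λ - 1` and `a = γ/(n-1)`.
The function `y^a r^(-(a+γ))`, homogeneous of degree `-γ`, is a subsolution for Pucci's operator:
its Hessian is a difference of positive semidefinite matrices whose weighted traces cancel exactly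
(`logBarrier_le_pucciInf`). Here `y` is the height above the plane `x_k = 1`, where this function
vanishes; that plane lies inside the half space, so no boundary condition is needed. Comparison
gives `u ≥ c R^(-γ)` on the ball, which contradicts the upper bound when `γ(pq-1) < 2(p+1)`. This
also covers `pq = 1`.

In the critical case `p = q` and `γ(p-1) = 2`, and the two powers of `R` agree. The lower bound for
`v` is then inserted as a source in the inequality for `u`; it pays for a logarithmic factor in the
barrier (`IsViscositySupersolution.exists_mul_log_le`), and `u ≥ δ R^(-γ) log R` is again too large.
-/

/-! ### Calculus of gradients and Hessian matrices -/

open Filter Topology in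
theorem contDiffAt_two_eventually_differentiableAt {n : ℕ} {φ : EuclideanSpace ℝ (Fin n) → ℝ}
    {x : EuclideanSpace ℝ (Fin n)} (h : ContDiffAt ℝ 2 φ x) :
    ∀ᶠ y in 𝓝 x, DifferentiableAt ℝ φ y :=
  (h.eventually (by simp)).mono fun _ hy => hy.differentiableAt (by norm_num)

theorem ContDiffAt.differentiableAt_fderiv_two {n : ℕ} {φ : EuclideanSpace ℝ (Fin n) → ℝ}
    {x : EuclideanSpace ℝ (Fin n)} (h : ContDiffAt ℝ 2 φ x) :
    DifferentiableAt ℝ (fderiv ℝ φ) x :=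
  (h.fderiv_right (m := 1) (by norm_num)).differentiableAt (by norm_num)

theorem hessian_apply_eq {n : ℕ} {φ : EuclideanSpace ℝ (Fin n) → ℝ}
    {x : EuclideanSpace ℝ (Fin n)} (h : ContDiffAt ℝ 2 φ x) (i j : Fin n) :
    hessian φ x i j =
      fderiv ℝ (fun y => fderiv ℝ φ y (EuclideanSpace.single j 1)) x
        (EuclideanSpace.single i 1) := by
  rw [fderiv_clm_apply h.differentiableAt_fderiv_two (differentiableAt_const _)]
  simp [hessian]

theorem hessian_isHermitian_of_contDiffAt {n : ℕ} {φ : EuclideanSpace ℝ (Fin n) → ℝ}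
    {x : EuclideanSpace ℝ (Fin n)} (h : ContDiffAt ℝ 2 φ x) : (hessian φ x).IsHermitian := by
  have h := h.isSymmSndFDerivAt (by simp)
  ext i j
  simpa [hessian] using h.eq _ _

/-- `φ` is `C²` near `x`, with gradient `G` and Hessian matrix `H` at `x`. -/
structure HasHessianAt {n : ℕ} (φ : EuclideanSpace ℝ (Fin n) → ℝ) (G : Fin n → ℝ)
    (H : Matrix (Fin n) (Fin n) ℝ) (x : EuclideanSpace ℝ (Fin n)) : Prop where
  contDiffAt : ContDiffAt ℝ 2 φ x
  fderiv_eq : ∀ i, fderiv ℝ φ x (EuclideanSpace.single i 1) = G i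
  hessian_eq : ∀ i j, hessian φ x i j = H i j

namespace HasHessianAt

variable {n : ℕ} {φ ψ : EuclideanSpace ℝ (Fin n) → ℝ} {G K : Fin n → ℝ}
  {H L : Matrix (Fin n) (Fin n) ℝ} {x : EuclideanSpace ℝ (Fin n)}

theorem const (c : ℝ) : HasHessianAt (fun _ => c) 0 0 x where
  contDiffAt := contDiffAt_const
  fderiv_eq i := by simp
  hessian_eq i j := by
    rw [hessian_apply_eq contDiffAt_const]
    simp

theorem coord (k : Fin n) (c : ℝ) :
    HasHessianAt (fun y => y k - c) (fun i => if i = k then 1 else 0) 0 x := by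
  have h1 : ContDiff ℝ 2 (fun y : EuclideanSpace ℝ (Fin n) => y k - c) := by fun_prop
  have h2 : ∀ y : EuclideanSpace ℝ (Fin n), ∀ i,
      fderiv ℝ (fun y : EuclideanSpace ℝ (Fin n) => y k - c) y (EuclideanSpace.single i 1)
        = if i = k then 1 else 0 := by
    intro y i
    have : HasFDerivAt (fun y : EuclideanSpace ℝ (Fin n) => y k - c)
        (EuclideanSpace.proj k : EuclideanSpace ℝ (Fin n) →L[ℝ] ℝ) y :=
      ((EuclideanSpace.proj k : EuclideanSpace ℝ (Fin n) →L[ℝ] ℝ).hasFDerivAt (x := y)).sub_const c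
    rw [this.fderiv]
    simp [eq_comm]
  refine ⟨h1.contDiffAt, h2 x, fun i j => ?_⟩
  rw [hessian_apply_eq h1.contDiffAt]
  simp only [h2]
  simp

open Filter Topology in
theorem add (h : HasHessianAt φ G H x) (h' : HasHessianAt ψ K L x) :
    HasHessianAt (fun y => φ y + ψ y) (fun i => G i + K i) (Matrix.of fun i j => H i j + L i j)
      x where
  contDiffAt := h.contDiffAt.add h'.contDiffAt
  fderiv_eq i := by
    rw [fderiv_fun_add (h.contDiffAt.differentiableAt (by norm_num))
      (h'.contDiffAt.differentiableAt (by norm_num))]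
    simp [h.fderiv_eq, h'.fderiv_eq]
  hessian_eq i j := by
    have e : fderiv ℝ (fun y => φ y + ψ y) =ᶠ[𝓝 x] fun y => fderiv ℝ φ y + fderiv ℝ ψ y := by
      filter_upwards [contDiffAt_two_eventually_differentiableAt h.contDiffAt,
        contDiffAt_two_eventually_differentiableAt h'.contDiffAt] with y h1 h2
      rw [fderiv_fun_add h1 h2]
    simp only [Matrix.of_apply, ← h.hessian_eq, ← h'.hessian_eq]
    simp only [hessian, Matrix.of_apply]
    rw [e.fderiv_eq, fderiv_fun_add h.contDiffAt.differentiableAt_fderiv_two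
      h'.contDiffAt.differentiableAt_fderiv_two]
    simp

open Filter Topology in
theorem mul (h : HasHessianAt φ G H x) (h' : HasHessianAt ψ K L x) :
    HasHessianAt (fun y => φ y * ψ y) (fun i => φ x * K i + ψ x * G i)
      (Matrix.of fun i j => φ x * L i j + ψ x * H i j + (G i * K j + K i * G j)) x where
  contDiffAt := h.contDiffAt.mul h'.contDiffAt
  fderiv_eq i := by
    rw [fderiv_fun_mul (h.contDiffAt.differentiableAt (by norm_num))
      (h'.contDiffAt.differentiableAt (by norm_num))]
    simp [h.fderiv_eq, h'.fderiv_eq]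
  hessian_eq i j := by
    have e : fderiv ℝ (fun y => φ y * ψ y) =ᶠ[𝓝 x]
        fun y => φ y • fderiv ℝ ψ y + ψ y • fderiv ℝ φ y := by
      filter_upwards [contDiffAt_two_eventually_differentiableAt h.contDiffAt,
        contDiffAt_two_eventually_differentiableAt h'.contDiffAt] with y h1 h2
      rw [fderiv_fun_mul h1 h2]
    have d1 := h.contDiffAt.differentiableAt (by norm_num)
    have d2 := h'.contDiffAt.differentiableAt (by norm_num)
    have d3 := h.contDiffAt.differentiableAt_fderiv_two
    have d4 := h'.contDiffAt.differentiableAt_fderiv_two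
    simp only [Matrix.of_apply, ← h.hessian_eq, ← h'.hessian_eq, ← h.fderiv_eq, ← h'.fderiv_eq]
    simp only [hessian, Matrix.of_apply]
    rw [e.fderiv_eq, fderiv_fun_add (d1.fun_smul d4) (d2.fun_smul d3), fderiv_fun_smul d1 d4,
      fderiv_fun_smul d2 d3]
    simp
    ring

open Filter Topology in
theorem comp {F F' : ℝ → ℝ} {F'' : ℝ} (h : HasHessianAt φ G H x)
    (hF : ContDiffAt ℝ 2 F (φ x)) (hF' : ∀ᶠ t in 𝓝 (φ x), HasDerivAt F (F' t) t)
    (hF'' : HasDerivAt F' F'' (φ x)) :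
    HasHessianAt (fun y => F (φ y)) (fun i => F' (φ x) * G i)
      (Matrix.of fun i j => F' (φ x) * H i j + F'' * (G i * G j)) x where
  contDiffAt := hF.comp x h.contDiffAt
  fderiv_eq i := by
    have := (hF'.self_of_nhds).comp_hasFDerivAt x
      (h.contDiffAt.differentiableAt (by norm_num)).hasFDerivAt
    have e : fderiv ℝ (fun y => F (φ y)) x = F' (φ x) • fderiv ℝ φ x := this.fderiv
    rw [e]
    simp [h.fderiv_eq]
  hessian_eq i j := by
    have e : fderiv ℝ (fun y => F (φ y)) =ᶠ[𝓝 x] fun y => F' (φ y) • fderiv ℝ φ y := by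
      filter_upwards [contDiffAt_two_eventually_differentiableAt h.contDiffAt,
        h.contDiffAt.continuousAt.eventually hF'] with y h1 h2
      exact (h2.comp_hasFDerivAt y h1.hasFDerivAt).fderiv
    have d1 := h.contDiffAt.differentiableAt (by norm_num)
    have d3 := h.contDiffAt.differentiableAt_fderiv_two
    have d5 := hF''.comp_hasFDerivAt x d1.hasFDerivAt
    have d5' : fderiv ℝ (fun y => F' (φ y)) x = F'' • fderiv ℝ φ x := d5.fderiv
    have d6 : DifferentiableAt ℝ (fun y => F' (φ y)) x := d5.differentiableAt
    simp only [Matrix.of_apply, ← h.hessian_eq, ← h.fderiv_eq]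
    simp only [hessian, Matrix.of_apply]
    rw [e.fderiv_eq, fderiv_fun_smul d6 d3, d5']
    simp
    ring

theorem congr {G' : Fin n → ℝ} {H' : Matrix (Fin n) (Fin n) ℝ} (h : HasHessianAt φ G H x)
    (hG : ∀ i, G i = G' i) (hH : ∀ i j, H i j = H' i j) : HasHessianAt φ G' H' x :=
  ⟨h.contDiffAt, fun i => (h.fderiv_eq i).trans (hG i),
    fun i j => (h.hessian_eq i j).trans (hH i j)⟩

theorem const_mul (c : ℝ) (h : HasHessianAt φ G H x) :
    HasHessianAt (fun y => c * φ y) (fun i => c * G i) (Matrix.of fun i j => c * H i j) x :=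
  ((const c).mul h).congr (fun i => by simp) (fun i j => by simp)

theorem sum {ι : Type*} (s : Finset ι) {φ : ι → EuclideanSpace ℝ (Fin n) → ℝ}
    {G : ι → Fin n → ℝ} {H : ι → Matrix (Fin n) (Fin n) ℝ}
    (h : ∀ i ∈ s, HasHessianAt (φ i) (G i) (H i) x) :
    HasHessianAt (fun y => ∑ k ∈ s, φ k y) (fun i => ∑ k ∈ s, G k i)
      (Matrix.of fun i j => ∑ k ∈ s, H k i j) x := by
  classical
  induction s using Finset.induction_on with
  | empty => exact (const 0).congr (by simp) (by simp)
  | insert a s ha ih =>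
    have h1 := (h a (by simp)).add (ih fun i hi => h i (by simp [hi]))
    simp only [Finset.sum_insert ha]
    exact h1.congr (fun i => rfl) (fun i j => rfl)

/-- Half the squared distance to `z`. -/
theorem half_sq_dist (z : EuclideanSpace ℝ (Fin n)) :
    HasHessianAt (fun y => ∑ k, (y k - z k) ^ 2 / 2) (fun i => x i - z i) 1 x := by
  have h : ∀ k ∈ (Finset.univ : Finset (Fin n)), HasHessianAt
      (fun y : EuclideanSpace ℝ (Fin n) => (y k - z k) ^ 2 / 2)
      (fun i => if i = k then x k - z k else 0)
      (Matrix.of fun i j => if i = k then if j = k then 1 else 0 else 0) x := fun k _ => by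
    refine ((coord (x := x) k (z k)).comp (F := fun t => t ^ 2 / 2) (F' := fun t => t) (F'' := 1)
      (by fun_prop) (Filter.Eventually.of_forall fun t => ?_) (hasDerivAt_id _)).congr
        (fun i => by simp) (fun i j => by simp [← ite_and, and_comm])
    simpa using ((hasDerivAt_pow 2 t).div_const 2)
  exact (HasHessianAt.sum _ h).congr (fun i => by simp) (fun i j => by
    simp [Matrix.one_apply, eq_comm])

end HasHessianAt

/-! ### Pucci's operator and viscosity test functions -/

/-- Splitting a symmetric matrix as a difference of positive semidefinite matrices bounds
Pucci's operator from below. -/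
theorem le_pucciInf_sub {n : ℕ} {lam Lam : ℝ} (hLam : lam ≤ Lam)
    {A B : Matrix (Fin n) (Fin n) ℝ} (hA : A.PosSemidef) (hB : B.PosSemidef) :
    lam * A.trace - Lam * B.trace ≤ pucciInf lam Lam (A - B) := by
  have hM : (A - B).IsHermitian := hA.1.sub hB.1
  rw [pucciInf_eq_sum_eigenvalues lam Lam hM]
  set U : Matrix (Fin n) (Fin n) ℝ := (hM.eigenvectorUnitary : Matrix (Fin n) (Fin n) ℝ) with hU
  have hUU : U * U.conjTranspose = 1 := Unitary.coe_mul_star_self hM.eigenvectorUnitary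
  have hUU' : U.conjTranspose * U = 1 := Unitary.coe_star_mul_self hM.eigenvectorUnitary
  have hA' := hA.conjTranspose_mul_mul_same U
  have hB' := hB.conjTranspose_mul_mul_same U
  have tA : A.trace = (U.conjTranspose * A * U).trace := by
    rw [Matrix.mul_assoc, Matrix.trace_mul_comm, Matrix.mul_assoc, hUU, Matrix.mul_one]
  have tB : B.trace = (U.conjTranspose * B * U).trace := by
    rw [Matrix.mul_assoc, Matrix.trace_mul_comm, Matrix.mul_assoc, hUU, Matrix.mul_one]
  -- In an eigenbasis of `A - B` only the diagonals of `A` and `B` matter: they are nonnegative, sum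
  -- to the traces, and differ by the eigenvalues.
  have hd : ∀ i, hM.eigenvalues i =
      (U.conjTranspose * A * U) i i - (U.conjTranspose * B * U) i i := by
    intro i
    have h := hM.spectral_theorem
    rw [Unitary.conjStarAlgAut_apply] at h
    have h2 : U.conjTranspose * (A - B) * U = Matrix.diagonal hM.eigenvalues := by
      conv_lhs => rw [h]
      change U.conjTranspose * (U * _ * U.conjTranspose) * U = _
      rw [Matrix.mul_assoc, Matrix.mul_assoc, Matrix.mul_assoc, hUU', Matrix.mul_one,
        ← Matrix.mul_assoc, hUU', Matrix.one_mul]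
      rfl
    have h3 := congrFun (congrFun h2 i) i
    rw [Matrix.mul_sub, Matrix.sub_mul] at h3
    simpa using h3.symm
  rw [tA, tB, Matrix.trace, Matrix.trace, Finset.mul_sum, Finset.mul_sum, Finset.sum_filter,
    Finset.sum_filter, Finset.mul_sum, Finset.mul_sum, ← Finset.sum_sub_distrib,
    ← Finset.sum_add_distrib]
  refine Finset.sum_le_sum fun i _ => ?_
  have a0 : 0 ≤ (U.conjTranspose * A * U) i i := hA'.diag_nonneg
  have b0 : 0 ≤ (U.conjTranspose * B * U) i i := hB'.diag_nonneg
  rw [hd i]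
  simp only [Matrix.diag_apply]
  generalize (U.conjTranspose * A * U) i i = α at *
  generalize (U.conjTranspose * B * U) i i = β at *
  rcases lt_trichotomy (α - β) 0 with h | h | h
  · rw [if_neg (by linarith), if_pos h]; nlinarith
  · rw [if_neg (by linarith), if_neg (by linarith)]
    obtain rfl : α = β := by linarith
    nlinarith [mul_le_mul_of_nonneg_right hLam a0]
  · rw [if_pos h, if_neg (by linarith)]; nlinarith

open Filter Topology in
/-- Only the germ of the test function at the touching point matters. -/
theorem IsViscositySupersolution.le_of_isLocalMin {n : ℕ}
    {F : EuclideanSpace ℝ (Fin n) → Matrix (Fin n) (Fin n) ℝ → ℝ}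
    {Ω : Set (EuclideanSpace ℝ (Fin n))} {u φ : EuclideanSpace ℝ (Fin n) → ℝ}
    {x₀ : EuclideanSpace ℝ (Fin n)} (hu : IsViscositySupersolution F Ω u) (hx₀ : x₀ ∈ Ω)
    (hφ : ContDiffAt ℝ 2 φ x₀) (hmin : IsLocalMin (fun x => u x - φ x) x₀) :
    F x₀ (hessian φ x₀) ≤ 0 := by
  obtain ⟨r, hr, hball⟩ := Metric.eventually_nhds_iff_ball.1 (hφ.eventually (by simp))
  -- Test functions must be `C²` on all of `Ω`; a cutoff equal to `1` near `x₀` extends `φ` without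
  -- changing its germ.
  let χ : ContDiffBump x₀ := ⟨r / 4, r / 2, by positivity, by linarith⟩
  have hloc : (fun x => χ x * φ x) =ᶠ[𝓝 x₀] φ := by
    filter_upwards [χ.eventuallyEq_one] with x hx
    simp [hx]
  have hsm : ContDiff ℝ 2 fun x => χ x * φ x := by
    refine contDiff_iff_contDiffAt.2 fun x => ?_
    by_cases hx : x ∈ tsupport (χ : EuclideanSpace ℝ (Fin n) → ℝ)
    · rw [χ.tsupport_eq] at hx
      refine χ.contDiff.contDiffAt.mul (hball x (Metric.closedBall_subset_ball ?_ hx))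
      change r / 2 < r
      linarith
    · refine (contDiffAt_const (c := (0 : ℝ))).congr_of_eventuallyEq ?_
      filter_upwards [notMem_tsupport_iff_eventuallyEq.1 hx] with y hy
      simp [hy]
  have h := hu.2 x₀ hx₀ (fun x => χ x * φ x) hsm.contDiffOn (IsLocalMin.on (hmin.congr
    (hloc.mono fun x hx => by simp only at hx; simp only [hx])) Ω)
  have e : hessian (fun x => χ x * φ x) x₀ = hessian φ x₀ := by
    ext i j
    simp only [hessian, Matrix.of_apply]
    rw [(hloc.fderiv (𝕜 := ℝ)).fderiv_eq]
  rwa [e] at h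

theorem IsViscositySupersolution.le_of_hasHessianAt {n : ℕ}
    {F : EuclideanSpace ℝ (Fin n) → Matrix (Fin n) (Fin n) ℝ → ℝ}
    {Ω : Set (EuclideanSpace ℝ (Fin n))} {u φ : EuclideanSpace ℝ (Fin n) → ℝ}
    {x₀ : EuclideanSpace ℝ (Fin n)} {G : Fin n → ℝ} {H : Matrix (Fin n) (Fin n) ℝ}
    (hu : IsViscositySupersolution F Ω u) (hx₀ : x₀ ∈ Ω)
    (hφ : HasHessianAt φ G H x₀) (hmin : IsLocalMin (fun x => u x - φ x) x₀) :
    F x₀ H ≤ 0 := by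
  have e : hessian φ x₀ = H := by ext i j; exact hφ.hessian_eq i j
  exact e ▸ hu.le_of_isLocalMin hx₀ hφ.contDiffAt hmin

/-- A continuous function on a compact set attains a local minimum in an open subset if its values
on the rest of the compact set are too large. -/
theorem exists_isLocalMin_of_lt {X : Type*} [TopologicalSpace X] {K U : Set X} {w : X → ℝ} {x₁ : X}
    (hK : IsCompact K) (hU : IsOpen U) (hUK : U ⊆ K) (hw : ContinuousOn w K) (hx₁ : x₁ ∈ K)
    (hlt : ∀ x ∈ K, x ∉ U → w x₁ < w x) : ∃ x₀ ∈ U, IsLocalMin w x₀ ∧ w x₀ ≤ w x₁ := by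
  obtain ⟨x₀, hx₀, hmin⟩ := hK.exists_isMinOn ⟨x₁, hx₁⟩ hw
  have h := isMinOn_iff.1 hmin
  have hx₀U : x₀ ∈ U := by
    by_contra hc
    exact absurd (h x₁ hx₁) (not_le.2 (hlt x₀ hx₀ hc))
  refine ⟨x₀, hx₀U, ?_, h x₁ hx₁⟩
  filter_upwards [hU.mem_nhds hx₀U] with y hy using h y (hUK hy)

/-! ### Paraboloids and radial barriers on balls -/

theorem posSemidef_vecMulVec_self {n : ℕ} (d : Fin n → ℝ) :
    (Matrix.vecMulVec d d).PosSemidef := by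
  simpa using Matrix.posSemidef_vecMulVec_self_star d

theorem sum_half_sq_sub_eq {n : ℕ} (x z : EuclideanSpace ℝ (Fin n)) :
    ∑ k, (x k - z k) ^ 2 / 2 = dist x z ^ 2 / 2 := by
  rw [EuclideanSpace.dist_eq, Real.sq_sqrt (Finset.sum_nonneg fun _ _ => by positivity),
    Finset.sum_div]
  simp [Real.dist_eq]

theorem half_sq_dist_hasHessianAt {n : ℕ} (z x : EuclideanSpace ℝ (Fin n)) :
    HasHessianAt (fun y => dist y z ^ 2 / 2) (fun i => x i - z i) 1 x := by
  simpa only [sum_half_sq_sub_eq] using HasHessianAt.half_sq_dist (x := x) z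

/-- Testing with a paraboloid. -/
theorem IsViscositySupersolution.exists_le_of_closedBall_subset {n : ℕ} {lam Lam : ℝ}
    (hLam : lam ≤ Lam) {g u : EuclideanSpace ℝ (Fin n) → ℝ} {Ω : Set (EuclideanSpace ℝ (Fin n))}
    (hu : IsViscositySupersolution (fun x M => pucciInf lam Lam M + g x) Ω u)
    (hpos : ∀ x ∈ Ω, 0 < u x) {y : EuclideanSpace ℝ (Fin n)} {R : ℝ} (hR : 0 < R)
    (hball : Metric.closedBall y R ⊆ Ω) :
    ∃ x ∈ Metric.closedBall y R, g x ≤ 4 * Lam * n * u y / R ^ 2 := by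
  have hy : 0 < u y := hpos y (hball (Metric.mem_closedBall_self hR.le))
  -- With this opening, `κ R²/2 = 2 u y` on the sphere, so the minimum of `u + κ |x - y|²/2` is
  -- attained in the open ball.
  set κ : ℝ := 4 * u y / R ^ 2 with hκ
  have hκ0 : 0 < κ := by positivity
  obtain ⟨x₀, hx₀, hmin, -⟩ := exists_isLocalMin_of_lt (K := Metric.closedBall y R)
    (U := Metric.ball y R) (w := fun x => u x - (-κ) * (dist x y ^ 2 / 2)) (x₁ := y)
    (isCompact_closedBall y R) Metric.isOpen_ball Metric.ball_subset_closedBall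
    ((hu.1.mono hball).sub (by fun_prop)) (Metric.mem_closedBall_self hR.le) (by
      intro x hx hx'
      have h1 : dist x y = R := le_antisymm (Metric.mem_closedBall.1 hx)
        (not_lt.1 fun h => hx' (Metric.mem_ball.2 h))
      have h2 := hpos x (hball hx)
      have h3 : κ * R ^ 2 = 4 * u y := by rw [hκ]; field_simp
      simp only [h1, dist_self]
      nlinarith)
  have hx₀' := Metric.ball_subset_closedBall hx₀
  refine ⟨x₀, hx₀', ?_⟩
  have h := hu.le_of_hasHessianAt (hball hx₀')
    ((half_sq_dist_hasHessianAt y x₀).const_mul (-κ)) hmin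
  have hB : (κ • (1 : Matrix (Fin n) (Fin n) ℝ)).PosSemidef := Matrix.PosSemidef.one.smul hκ0.le
  have h2 := le_pucciInf_sub hLam (Matrix.PosSemidef.zero (n := Fin n) (R := ℝ)) hB
  have e : (Matrix.of fun i j => -κ * (1 : Matrix (Fin n) (Fin n) ℝ) i j)
      = 0 - κ • (1 : Matrix (Fin n) (Fin n) ℝ) := by
    ext i j; simp
  rw [e] at h
  simp only [Matrix.trace_zero, Matrix.trace_smul, Matrix.trace_one, Fintype.card_fin,
    smul_eq_mul] at h2
  have e2 : 4 * Lam * n * u y / R ^ 2 = Lam * (κ * n) := by rw [hκ]; ring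
  rw [e2]
  linarith

/-- Propagation of lower bounds from a ball to a larger concentric ball. -/
theorem IsViscositySupersolution.annulus_le {n : ℕ} (hn : 0 < n) {lam Lam : ℝ} (hlam : 0 < lam)
    (hLam : lam ≤ Lam) {g u : EuclideanSpace ℝ (Fin n) → ℝ} {Ω : Set (EuclideanSpace ℝ (Fin n))}
    (hu : IsViscositySupersolution (fun x M => pucciInf lam Lam M + g x) Ω u)
    (hnn : ∀ x ∈ Ω, 0 ≤ u x) (hg : ∀ x ∈ Ω, 0 ≤ g x) {z : EuclideanSpace ℝ (Fin n)} {ρ R m : ℝ}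
    (hρ : 0 < ρ) (hρR : ρ < R) (hm : 0 < m) (hball : Metric.closedBall z R ⊆ Ω)
    (hmu : ∀ x ∈ Metric.sphere z ρ, m ≤ u x) {x : EuclideanSpace ℝ (Fin n)}
    (hx1 : ρ ≤ dist x z) (hx2 : dist x z ≤ R) :
    m * (((dist x z ^ 2 / 2) ^ (-(Lam * n / lam)) - (R ^ 2 / 2) ^ (-(Lam * n / lam))) /
      ((ρ ^ 2 / 2) ^ (-(Lam * n / lam)) - (R ^ 2 / 2) ^ (-(Lam * n / lam)))) ≤ u x := by
  have hn' : (0 : ℝ) < n := by exact_mod_cast hn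
  -- The exponent is larger than necessary, so that `s^(-α)` is a strict subsolution: the weighted
  -- traces leave the surplus `2λα + 2λ - Λn = Λn + 2λ > 0`.
  set α : ℝ := Lam * n / lam with hα
  have hα0 : 0 < α := by have : 0 < Lam := hlam.trans_le hLam; positivity
  have hαe : lam * α = Lam * n := by rw [hα]; field_simp
  set D : ℝ := (ρ ^ 2 / 2) ^ (-α) - (R ^ 2 / 2) ^ (-α) with hD
  have hD0 : 0 < D := by
    have := Real.rpow_lt_rpow_of_neg (x := ρ ^ 2 / 2) (y := R ^ 2 / 2) (z := -α) (by positivity)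
      (by nlinarith) (by linarith)
    linarith
  set κ := m / D with hκ
  have hκ0 : 0 < κ := div_pos hm hD0
  rw [mul_div_assoc', mul_comm, mul_div_assoc, mul_comm, ← hκ]
  by_contra hc
  rw [not_le] at hc
  have hKc : IsCompact (Metric.closedBall z R ∩ {x | ρ ≤ dist x z}) :=
    (isCompact_closedBall z R).inter_right (isClosed_le continuous_const (by fun_prop))
  obtain ⟨x₀, hx₀, hmin, -⟩ := exists_isLocalMin_of_lt
    (U := Metric.ball z R ∩ {x | ρ < dist x z})
    (w := fun x => u x - κ * ((dist x z ^ 2 / 2) ^ (-α) + -(R ^ 2 / 2) ^ (-α)))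
    (x₁ := x) hKc (Metric.isOpen_ball.inter (isOpen_lt continuous_const (by fun_prop)))
    (Set.inter_subset_inter Metric.ball_subset_closedBall fun y (hy : ρ < dist y z) => hy.le)
    ((hu.1.mono (Set.inter_subset_left.trans hball)).sub (by
      refine ContinuousOn.mul continuousOn_const (ContinuousOn.add ?_ continuousOn_const)
      refine ContinuousOn.rpow_const (by fun_prop) fun y hy => Or.inl ?_
      have : 0 < dist y z := hρ.trans_le hy.2
      positivity)) ⟨hx2, hx1⟩ (by
      intro y hy hy'
      have h0 : u x - κ * ((dist x z ^ 2 / 2) ^ (-α) + -(R ^ 2 / 2) ^ (-α)) < 0 := by linarith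
      refine h0.trans_le ?_
      rcases eq_or_lt_of_le (show dist y z ≤ R from hy.1) with h | h
      · rw [h]
        simpa using hnn y (hball hy.1)
      · have h' : dist y z = ρ := le_antisymm (not_lt.1 fun h2 => hy' ⟨h, h2⟩) hy.2
        have := hmu y h'
        rw [h', ← sub_eq_add_neg, ← hD, hκ, div_mul_cancel₀ _ hD0.ne']
        linarith)
  have hd : 0 < dist x₀ z := hρ.trans hx₀.2
  have hx₀Ω : x₀ ∈ Ω := hball (Metric.ball_subset_closedBall hx₀.1)
  set s : ℝ := dist x₀ z ^ 2 / 2 with hs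
  have hs0 : 0 < s := by positivity
  have hH := (((half_sq_dist_hasHessianAt z x₀).comp (F := fun t => t ^ (-α))
    (F' := fun t => -α * t ^ (-α - 1)) (F'' := -α * ((-α - 1) * s ^ (-α - 1 - 1)))
    (Real.contDiffAt_rpow_const_of_ne hs0.ne') (by
      filter_upwards [lt_mem_nhds hs0] with t ht
      exact Real.hasDerivAt_rpow_const (Or.inl ht.ne'))
    ((Real.hasDerivAt_rpow_const (Or.inl hs0.ne')).const_mul _)).add
      (HasHessianAt.const (-(R ^ 2 / 2) ^ (-α)))).const_mul κ
  have h := hu.le_of_hasHessianAt hx₀Ω hH hmin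
  have hA : ((κ * (α * (α + 1) * s ^ (-α - 2))) • Matrix.vecMulVec (fun i => x₀ i - z i)
      (fun i => x₀ i - z i)).PosSemidef := (posSemidef_vecMulVec_self _).smul (by positivity)
  have hB : ((κ * (α * s ^ (-α - 1))) • (1 : Matrix (Fin n) (Fin n) ℝ)).PosSemidef :=
    Matrix.PosSemidef.one.smul (by positivity)
  have h2 := le_pucciInf_sub hLam hA hB
  have htr : (fun i => x₀ i - z i) ⬝ᵥ (fun i => x₀ i - z i) = 2 * s := by
    have := sum_half_sq_sub_eq x₀ z
    rw [← Finset.sum_div] at this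
    simp only [dotProduct, ← pow_two]
    linarith
  simp only [Matrix.trace_smul, Matrix.trace_one, Fintype.card_fin, smul_eq_mul,
    Matrix.trace_vecMulVec, htr] at h2
  have e1 : s ^ (-α - 1) = s ^ (-α - 2) * s := by
    rw [show -α - 1 = (-α - 2) + 1 by ring, Real.rpow_add_one hs0.ne']
  have hmat : ((κ * (α * (α + 1) * s ^ (-α - 2))) • Matrix.vecMulVec (fun i => x₀ i - z i)
      (fun i => x₀ i - z i)) - ((κ * (α * s ^ (-α - 1))) • (1 : Matrix (Fin n) (Fin n) ℝ))
      = Matrix.of fun i j => κ * (Matrix.of (fun i j => (Matrix.of fun i j =>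
        (-α * s ^ (-α - 1)) * (1 : Matrix (Fin n) (Fin n) ℝ) i j +
        (-α * ((-α - 1) * s ^ (-α - 1 - 1))) * ((x₀ i - z i) * (x₀ j - z j))) i j +
        (0 : Matrix (Fin n) (Fin n) ℝ) i j)) i j := by
    ext i j
    simp [Matrix.vecMulVec_apply]
    rw [show -α - 1 - 1 = -α - 2 by ring]
    ring
  rw [hmat] at h2
  have hg0 := hg x₀ hx₀Ω
  have hq : 0 < κ * α * s ^ (-α - 2) * s := by positivity
  have h3 : lam * (κ * (α * (α + 1) * s ^ (-α - 2)) * (2 * s)) -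
      Lam * (κ * (α * s ^ (-α - 1)) * n) =
      κ * α * s ^ (-α - 2) * s * (2 * (lam * α) + 2 * lam - Lam * n) := by rw [e1]; ring
  rw [h3, hαe] at h2
  have hLn : 0 < Lam * n := by rw [← hαe]; positivity
  have h4 : 0 < κ * α * s ^ (-α - 2) * s * (2 * (Lam * n) + 2 * lam - Lam * n) :=
    mul_pos hq (by linarith)
  linarith

/-! ### The half space and the strong minimum principle -/

theorem mem_upperHalfSpace_iff {n : ℕ} {k : Fin n} (hk : (k : ℕ) + 1 = n)
    {x : EuclideanSpace ℝ (Fin n)} : x ∈ upperHalfSpace n ↔ 0 < x k :=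
  ⟨fun h => h k hk, fun h i hi => by
    have : i = k := Fin.ext (by omega)
    rwa [this]⟩

theorem isOpen_upperHalfSpace (n : ℕ) : IsOpen (upperHalfSpace n) := by
  have : upperHalfSpace n = ⋂ i : Fin n, {x | (i : ℕ) + 1 = n → 0 < x i} := by
    ext x; simp [upperHalfSpace]
  rw [this]
  refine isOpen_iInter_of_finite fun i => ?_
  by_cases h : (i : ℕ) + 1 = n
  · simpa [h] using isOpen_lt continuous_const (by fun_prop)
  · simp [h]

theorem convex_upperHalfSpace (n : ℕ) : Convex ℝ (upperHalfSpace n) := by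
  intro x hx y hy a b ha hb hab i hi
  have h1 := hx i hi
  have h2 := hy i hi
  simp only [PiLp.add_apply, PiLp.smul_apply, smul_eq_mul]
  rcases eq_or_lt_of_le ha with h | h
  · have : b = 1 := by linarith
    simp [← h, this, h2]
  · nlinarith [mul_pos h h1, mul_nonneg hb h2.le]

theorem abs_apply_sub_le_dist {n : ℕ} (x y : EuclideanSpace ℝ (Fin n)) (k : Fin n) :
    |x k - y k| ≤ dist x y := by
  rw [dist_eq_norm]
  simpa using PiLp.norm_apply_le (x - y) k

theorem closedBall_subset_upperHalfSpace {n : ℕ} {k : Fin n} (hk : (k : ℕ) + 1 = n)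
    {z : EuclideanSpace ℝ (Fin n)} {R : ℝ} (hR : R < z k) :
    Metric.closedBall z R ⊆ upperHalfSpace n := fun x hx => by
  rw [mem_upperHalfSpace_iff hk]
  have := (abs_le.1 ((abs_apply_sub_le_dist x z k).trans hx)).1
  linarith

open Filter Topology in
/-- Strong minimum principle. -/
theorem IsViscositySupersolution.eq_zero_or_pos {n : ℕ} (hn : 0 < n) {lam Lam : ℝ}
    (hlam : 0 < lam) (hLam : lam ≤ Lam) {g u : EuclideanSpace ℝ (Fin n) → ℝ}
    (hu : IsViscositySupersolution (fun x M => pucciInf lam Lam M + g x) (upperHalfSpace n) u)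
    (hnn : ∀ x ∈ upperHalfSpace n, 0 ≤ u x) (hg : ∀ x ∈ upperHalfSpace n, 0 ≤ g x) :
    (∀ x ∈ upperHalfSpace n, u x = 0) ∨ ∀ x ∈ upperHalfSpace n, 0 < u x := by
  obtain ⟨k, hk⟩ : ∃ k : Fin n, (k : ℕ) + 1 = n := ⟨⟨n - 1, by omega⟩, by simp; omega⟩
  by_cases hz : ∀ x ∈ upperHalfSpace n, u x = 0
  · exact Or.inl hz
  right
  push Not at hz
  obtain ⟨x₁, hx₁, hux₁⟩ := hz
  -- Positivity at `y` spreads to the largest ball about `y` in the half space, by the annulus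
  -- barrier started from a small ball where `u > u y / 2`.
  have key : ∀ y ∈ upperHalfSpace n, 0 < u y → ∀ x, dist x y < y k → 0 < u x := by
    intro y hy huy x hx
    have hyk := (mem_upperHalfSpace_iff hk).1 hy
    obtain ⟨ρ₀, hρ₀, hb⟩ := Metric.eventually_nhds_iff_ball.1
      (((hu.1.continuousAt ((isOpen_upperHalfSpace n).mem_nhds hy)).eventually
        (lt_mem_nhds (half_lt_self huy))))
    rcases lt_or_ge (dist x y) ρ₀ with h | h
    · exact (half_pos huy).trans (hb x h)
    obtain ⟨R, hR1, hR2⟩ := exists_between hx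
    have hρ1 : 0 < ρ₀ / 2 := by positivity
    have hball := closedBall_subset_upperHalfSpace hk hR2
    refine lt_of_lt_of_le ?_ (hu.annulus_le hn hlam hLam hnn hg (ρ := ρ₀ / 2) (R := R)
      hρ1 (by linarith) (half_pos huy) hball (fun w hw => (hb w (by
        rw [Metric.mem_ball, Metric.mem_sphere.1 hw]; linarith)).le) (x := x) (by linarith) hR1.le)
    have hd : 0 < dist x y := hρ₀.trans_le h
    have hα0 : 0 < Lam * n / lam := by
      have : 0 < Lam := hlam.trans_le hLam
      have : (0 : ℝ) < n := by exact_mod_cast hn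
      positivity
    refine mul_pos (half_pos huy) (div_pos (sub_pos.2 ?_) (sub_pos.2 ?_))
    · exact Real.rpow_lt_rpow_of_neg (by positivity) (by nlinarith) (by linarith)
    · exact Real.rpow_lt_rpow_of_neg (by positivity) (by nlinarith) (by linarith)
  -- Hence the positivity set, which is open, is also relatively closed: a limit point `x` lies
  -- within `x k / 4` of some `y` in the set, whose height exceeds that distance.
  have hsub := (convex_upperHalfSpace n).isPreconnected.subset_of_closure_inter_subset
    (u := {x | x ∈ upperHalfSpace n ∧ 0 < u x})
    (hu.1.isOpen_inter_preimage (isOpen_upperHalfSpace n) isOpen_Ioi)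
    ⟨x₁, hx₁, hx₁, lt_of_le_of_ne (hnn x₁ hx₁) (Ne.symm hux₁)⟩ (by
      rintro x ⟨hxc, hx⟩
      have hxk := (mem_upperHalfSpace_iff hk).1 hx
      obtain ⟨y, hy, hxy⟩ := Metric.mem_closure_iff.1 hxc (x k / 4) (by positivity)
      refine ⟨hx, key y hy.1 hy.2 x ?_⟩
      have := (abs_le.1 ((abs_apply_sub_le_dist x y k).trans hxy.le)).2
      linarith)
  exact fun x hx => (hsub hx).2

theorem pucciInf_zero {n : ℕ} (lam Lam : ℝ) :
    pucciInf lam Lam (0 : Matrix (Fin n) (Fin n) ℝ) = 0 := by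
  rw [pucciInf_eq_sum_eigenvalues lam Lam Matrix.isHermitian_zero]
  have : (Matrix.isHermitian_zero : (0 : Matrix (Fin n) (Fin n) ℝ).IsHermitian).eigenvalues = 0 :=
    Matrix.IsHermitian.eigenvalues_eq_zero_iff _ |>.2 rfl
  simp [this]

open Filter Topology in
/-- The source term vanishes if the supersolution does. -/
theorem IsViscositySupersolution.source_eq_zero {n : ℕ} {lam Lam : ℝ}
    {g u : EuclideanSpace ℝ (Fin n) → ℝ} {Ω : Set (EuclideanSpace ℝ (Fin n))} (hΩ : IsOpen Ω)
    (hu : IsViscositySupersolution (fun x M => pucciInf lam Lam M + g x) Ω u)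
    (hg : ∀ x ∈ Ω, 0 ≤ g x) (h0 : ∀ x ∈ Ω, u x = 0) : ∀ x ∈ Ω, g x = 0 := by
  intro x hx
  refine le_antisymm ?_ (hg x hx)
  have h := hu.le_of_hasHessianAt hx (HasHessianAt.const 0) (by
    filter_upwards [hΩ.mem_nhds hx] with y hy
    simp [h0 x hx, h0 y hy])
  simpa [pucciInf_zero] using h

/-! ### The homogeneous barrier and its logarithmic variant -/

namespace HasHessianAt

variable {n : ℕ}

theorem log_coord (k : Fin n) {x : EuclideanSpace ℝ (Fin n)} (c : ℝ) (hx : 0 < x k - c) :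
    HasHessianAt (fun y => Real.log (y k - c)) (fun i => if i = k then (x k - c)⁻¹ else 0)
      (Matrix.of fun i j => -((if i = k then (x k - c)⁻¹ else 0) *
        (if j = k then (x k - c)⁻¹ else 0))) x := by
  have h := (coord (x := x) k c).comp (F := Real.log) (F' := fun t => t⁻¹)
    (F'' := -((x k - c) ^ 2)⁻¹) (Real.contDiffAt_log.2 hx.ne')
    (by filter_upwards [lt_mem_nhds hx] with t ht using Real.hasDerivAt_log ht.ne')
    (hasDerivAt_inv hx.ne')
  refine h.congr (fun i => by simp) (fun i j => ?_)
  by_cases hi : i = k <;> by_cases hj : j = k <;> simp [hi, hj, pow_two]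

theorem log_dist {z x : EuclideanSpace ℝ (Fin n)} (hx : 0 < dist x z) :
    HasHessianAt (fun y => Real.log (dist y z)) (fun i => (x i - z i) / dist x z ^ 2)
      (Matrix.of fun i j => (1 : Matrix (Fin n) (Fin n) ℝ) i j / dist x z ^ 2
        - 2 * ((x i - z i) * (x j - z j)) / dist x z ^ 4) x := by
  -- Writing the logarithm through half the squared distance reduces to a smooth inner function with
  -- identity Hessian.
  have e : (fun y : EuclideanSpace ℝ (Fin n) => Real.log (dist y z)) =
      fun y => (fun t => Real.log (2 * t) / 2) (dist y z ^ 2 / 2) := by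
    funext y
    simp only
    rw [mul_div_cancel₀ _ (two_ne_zero), Real.log_pow]
    simp
  rw [e]
  set r := dist x z with hr
  have hs : 0 < r ^ 2 / 2 := by positivity
  have h := (half_sq_dist_hasHessianAt z x).comp (F := fun t => Real.log (2 * t) / 2)
    (F' := fun t => (1 / 2) * t⁻¹) (F'' := (1 / 2) * -((r ^ 2 / 2) ^ 2)⁻¹)
    ((ContDiffAt.log (by fun_prop) (by positivity)).div_const _)
    (by
      filter_upwards [lt_mem_nhds hs] with t ht
      have := (((hasDerivAt_id t).const_mul 2).log (by simpa using ht.ne')).div_const 2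
      refine HasDerivAt.congr_deriv this ?_
      simp only [id]
      field_simp)
    ((hasDerivAt_inv hs.ne').const_mul _)
  refine h.congr (fun i => ?_) (fun i j => ?_)
  · rw [← hr]; field_simp
  · simp only [Matrix.of_apply]
    rw [← hr]; field_simp; ring

end HasHessianAt

/-- The family of barriers `yᵃ r⁻ᵇ (c₀ + c₁ log y + c₂ log r)`, where `y` is the height above the
hyperplane `x k = 1` and `r` the distance to the `k`-th unit vector. -/
noncomputable def logBarrier {n : ℕ} (k : Fin n) (a b c₀ c₁ c₂ : ℝ)
    (x : EuclideanSpace ℝ (Fin n)) : ℝ :=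
  Real.exp (a * Real.log (x k - 1) + -b * Real.log (dist x (EuclideanSpace.single k 1))) *
    ((c₀ + c₁ * Real.log (x k - 1)) + c₂ * Real.log (dist x (EuclideanSpace.single k 1)))

theorem coord_sub_le_dist_single {n : ℕ} (k : Fin n) (x : EuclideanSpace ℝ (Fin n)) :
    x k - 1 ≤ dist x (EuclideanSpace.single k 1) := by
  have := (abs_le.1 (abs_apply_sub_le_dist x (EuclideanSpace.single k 1) k)).2
  simpa using this

/-- Here `w` is the radial unit vector, and `η` is the part of `(r/y) e_k` orthogonal to it, `y = x
k - 1`. In this frame `r ∇(log f) = aη - γw` and `r ∇Ψ = δ(Cη + w)`. The terms carrying `Ψ` are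
collected by completing the square in `w - (a/γ)η`. The mixed `η, w` terms carrying `δ` have
coefficient `δ(a - (γ+1)C)`, so `C` is chosen to remove them. What remains is grouped by sign, ready
for `le_pucciInf_sub`. -/
theorem logBarrier_hasHessianAt {n : ℕ} (k : Fin n) {a γ C : ℝ} (hγ : γ ≠ 0)
    (hC : C * (γ + 1) = a) (c₀ δ : ℝ) {x : EuclideanSpace ℝ (Fin n)} (hx : 0 < x k - 1)
    {r : ℝ} (hr : r = dist x (EuclideanSpace.single k 1)) {Ψ f : ℝ}
    (hΨ : Ψ = (c₀ + δ * C * Real.log (x k - 1)) + δ * (1 - C) * Real.log r)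
    (hf : f = Real.exp (a * Real.log (x k - 1) + -(a + γ) * Real.log r))
    {w η : Fin n → ℝ}
    (hw : w = fun i => (x i - EuclideanSpace.single k (1 : ℝ) i) / r)
    (hη : η = fun i => (if i = k then r / (x k - 1) else 0) - w i) :
    ∃ G, HasHessianAt (logBarrier k a (a + γ) c₀ (δ * C) (δ * (1 - C))) G
      ((f / r ^ 2) • ((Ψ * (γ * (γ + 1))) • Matrix.vecMulVec (fun i => w i - a / γ * η i)
            (fun i => w i - a / γ * η i)
          + (δ * (C * (2 * a - 1))) • Matrix.vecMulVec η η
          + (δ * (1 - C)) • (1 : Matrix (Fin n) (Fin n) ℝ))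
        - (f / r ^ 2) • ((Ψ * (a + γ)) • ((1 : Matrix (Fin n) (Fin n) ℝ) - Matrix.vecMulVec w w)
          + (Ψ * (a * (a + γ) / γ)) • Matrix.vecMulVec η η
          + (δ * (2 * γ + 2 - C)) • Matrix.vecMulVec w w)) x := by
  have hr0 : 0 < r := hr ▸ hx.trans_le (coord_sub_le_dist_single k x)
  have hX := HasHessianAt.log_coord k 1 hx
  have hY := HasHessianAt.log_dist (hr ▸ hr0 : 0 < dist x (EuclideanSpace.single k 1))
  have hP := (hX.const_mul a).add (hY.const_mul (-(a + γ)))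
  have hE := hP.comp (F := Real.exp) (F' := Real.exp) (F'' := Real.exp (a * Real.log (x k - 1)
      + -(a + γ) * Real.log (dist x (EuclideanSpace.single k 1))))
    Real.contDiff_exp.contDiffAt (Filter.Eventually.of_forall Real.hasDerivAt_exp)
    (Real.hasDerivAt_exp _)
  have hL := ((HasHessianAt.const c₀).add (hX.const_mul (δ * C))).add
    (hY.const_mul (δ * (1 - C)))
  refine ⟨_, (hE.mul hL).congr (fun _ => rfl) fun i j => ?_⟩
  simp only [Matrix.of_apply, Matrix.sub_apply, Matrix.add_apply, Matrix.smul_apply, smul_eq_mul,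
    Matrix.vecMulVec_apply, Matrix.zero_apply, Pi.zero_apply]
  rw [← hr, ← hf, ← hΨ]
  have hwi : ∀ i, (x i - EuclideanSpace.single k (1 : ℝ) i) = r * w i := fun i => by
    rw [hw]; field_simp
  have hηi : ∀ i, (if i = k then (x k - 1)⁻¹ else 0) = (η i + w i) / r := fun i => by
    rw [hη]
    by_cases h : i = k <;> simp [h]
    field_simp
  rw [hwi i, hwi j, hηi i, hηi j]
  generalize (1 : Matrix (Fin n) (Fin n) ℝ) i j = I
  generalize w i = w1
  generalize w j = w2
  generalize η i = e1
  generalize η j = e2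
  clear hwi hηi hw hη hΨ hf hX hY hP hE hL
  subst hC
  field_simp
  ring

theorem posSemidef_one_sub_vecMulVec {n : ℕ} {w : Fin n → ℝ} (hw : w ⬝ᵥ w = 1) :
    ((1 : Matrix (Fin n) (Fin n) ℝ) - Matrix.vecMulVec w w).PosSemidef := by
  refine .of_dotProduct_mulVec_nonneg (Matrix.isHermitian_one.sub (posSemidef_vecMulVec_self w).1)
    fun ξ => ?_
  have h := Finset.sum_mul_sq_le_sq_mul_sq Finset.univ ξ w
  have h1 : ∑ i, w i ^ 2 = 1 := by simpa [dotProduct, pow_two] using hw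
  rw [h1, mul_one] at h
  have h2 : star ξ ⬝ᵥ ((1 : Matrix (Fin n) (Fin n) ℝ) - Matrix.vecMulVec w w).mulVec ξ =
      ∑ i, ξ i ^ 2 - (∑ i, ξ i * w i) ^ 2 := by
    rw [Matrix.sub_mulVec, Matrix.one_mulVec, Matrix.vecMulVec_mulVec, dotProduct_sub]
    simp [dotProduct, pow_two, Finset.mul_sum, Finset.sum_mul]
    refine Finset.sum_congr rfl fun i _ => Finset.sum_congr rfl fun j _ => ?_
    ring
  rw [h2]
  linarith

/-- The logarithmic barrier is an approximate subsolution wherever its logarithmic factor is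
nonnegative. -/
theorem logBarrier_le_pucciInf {n : ℕ} (hn : 2 ≤ n) {lam Lam : ℝ} (hlam : 0 < lam)
    (hLam : lam ≤ Lam) (k : Fin n) {a γ C : ℝ} (hγ : γ = Lam * n / lam - 1)
    (ha : a = γ / (n - 1)) (hC : C * (γ + 1) = a) {c₀ δ : ℝ} (hδ : 0 ≤ δ)
    {x : EuclideanSpace ℝ (Fin n)} (hx : 0 < x k - 1)
    (hΨ : 0 ≤ (c₀ + δ * C * Real.log (x k - 1)) +
      δ * (1 - C) * Real.log (dist x (EuclideanSpace.single k 1))) :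
    ∃ G H, HasHessianAt (logBarrier k a (a + γ) c₀ (δ * C) (δ * (1 - C))) G H x ∧
      δ * (Real.exp (a * Real.log (x k - 1) +
          -(a + γ) * Real.log (dist x (EuclideanSpace.single k 1))) /
        dist x (EuclideanSpace.single k 1) ^ 2) *
        (lam * (C * (2 * a - 1)) * (dist x (EuclideanSpace.single k 1) ^ 2 / (x k - 1) ^ 2 - 1)
          - Lam * (2 * γ + 2 - C)) ≤ pucciInf lam Lam H := by
  have hn' : (2 : ℝ) ≤ n := by exact_mod_cast hn
  have hLam0 : 0 < Lam := hlam.trans_le hLam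
  have hlγ : lam * (γ + 1) = Lam * n := by rw [hγ]; field_simp; ring
  have hγn : (n : ℝ) - 1 ≤ γ := by nlinarith
  have hγ0 : 0 < γ := by linarith
  have han : a * (n - 1) = γ := by
    rw [ha, div_mul_cancel₀]
    linarith
  have ha1 : 1 ≤ a := by nlinarith
  have haγ : a ≤ γ := by nlinarith
  have hC0 : 0 < C := by
    by_contra h
    nlinarith
  have hC1 : C ≤ 1 := by
    by_contra h
    nlinarith
  set r := dist x (EuclideanSpace.single k 1) with hr
  have hr0 : 0 < r := hr ▸ hx.trans_le (coord_sub_le_dist_single k x)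
  set f := Real.exp (a * Real.log (x k - 1) + -(a + γ) * Real.log r) with hf
  have hf0 : 0 < f := Real.exp_pos _
  set Ψ := (c₀ + δ * C * Real.log (x k - 1)) + δ * (1 - C) * Real.log r with hΨd
  obtain ⟨w, hw⟩ : ∃ w : Fin n → ℝ,
    w = fun i => (x i - EuclideanSpace.single k (1 : ℝ) i) / r := ⟨_, rfl⟩
  obtain ⟨η, hη⟩ : ∃ η : Fin n → ℝ,
    η = fun i => (if i = k then r / (x k - 1) else 0) - w i := ⟨_, rfl⟩
  obtain ⟨G, hH⟩ := logBarrier_hasHessianAt k hγ0.ne' hC c₀ δ hx hr hΨd hf hw hη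
  refine ⟨G, _, hH, ?_⟩
  have hww : w ⬝ᵥ w = 1 := by
    have h := sum_half_sq_sub_eq x (EuclideanSpace.single k 1)
    rw [← hr, ← Finset.sum_div] at h
    have h' : ∑ i, (x i - EuclideanSpace.single k (1 : ℝ) i) ^ 2 = r ^ 2 := by linarith
    have h2 : w ⬝ᵥ w = (∑ i, (x i - EuclideanSpace.single k (1 : ℝ) i) ^ 2) / r ^ 2 := by
      rw [hw, dotProduct, Finset.sum_div]
      exact Finset.sum_congr rfl fun i _ => by ring
    rw [h2, h', div_self (by positivity)]
  have hwk : w k = (x k - 1) / r := by rw [hw]; simp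
  have hwη : w ⬝ᵥ η = 0 := by
    have h : w ⬝ᵥ η = w k * (r / (x k - 1)) - w ⬝ᵥ w := by
      rw [hη]
      simp [dotProduct, mul_sub, Finset.sum_sub_distrib]
    rw [h, hww, hwk]
    field_simp
    ring
  have hηη : η ⬝ᵥ η = r ^ 2 / (x k - 1) ^ 2 - 1 := by
    have h : η ⬝ᵥ η = (r / (x k - 1)) * η k - w ⬝ᵥ η := by
      nth_rewrite 1 [hη]
      simp [dotProduct, sub_mul, Finset.sum_sub_distrib]
    rw [h, hwη, hη]
    simp only [if_true]
    rw [hwk]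
    field_simp
    ring
  have hηη0 : 0 ≤ η ⬝ᵥ η := by
    rw [dotProduct]
    exact Finset.sum_nonneg fun i _ => mul_self_nonneg _
  have hzz : (fun i => w i - a / γ * η i) ⬝ᵥ (fun i => w i - a / γ * η i) =
      1 + (a / γ) ^ 2 * (η ⬝ᵥ η) := by
    have h : (fun i => w i - a / γ * η i) ⬝ᵥ (fun i => w i - a / γ * η i) =
        w ⬝ᵥ w - 2 * (a / γ) * (w ⬝ᵥ η) + (a / γ) ^ 2 * (η ⬝ᵥ η) := by
      simp only [dotProduct, Finset.mul_sum, ← Finset.sum_sub_distrib, ← Finset.sum_add_distrib]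
      exact Finset.sum_congr rfl fun i _ => by ring
    rw [h, hww, hwη]
    ring
  have hfr : 0 < f / r ^ 2 := by positivity
  have hA : ((f / r ^ 2) • ((Ψ * (γ * (γ + 1))) • Matrix.vecMulVec (fun i => w i - a / γ * η i)
            (fun i => w i - a / γ * η i)
          + (δ * (C * (2 * a - 1))) • Matrix.vecMulVec η η
          + (δ * (1 - C)) • (1 : Matrix (Fin n) (Fin n) ℝ))).PosSemidef := by
    refine ((((posSemidef_vecMulVec_self _).smul ?_).add ((posSemidef_vecMulVec_self _).smul
      ?_)).add (Matrix.PosSemidef.one.smul ?_)).smul hfr.le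
    · positivity
    · exact mul_nonneg hδ (mul_nonneg hC0.le (by linarith))
    · exact mul_nonneg hδ (by linarith)
  have hB : ((f / r ^ 2) • ((Ψ * (a + γ)) • ((1 : Matrix (Fin n) (Fin n) ℝ) - Matrix.vecMulVec w w)
          + (Ψ * (a * (a + γ) / γ)) • Matrix.vecMulVec η η
          + (δ * (2 * γ + 2 - C)) • Matrix.vecMulVec w w)).PosSemidef := by
    refine ((((posSemidef_one_sub_vecMulVec hww).smul ?_).add ((posSemidef_vecMulVec_self _).smul
      ?_)).add ((posSemidef_vecMulVec_self _).smul ?_)).smul hfr.le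
    · positivity
    · positivity
    · exact mul_nonneg hδ (by linarith)
  refine le_trans ?_ (le_pucciInf_sub hLam hA hB)
  simp only [Matrix.trace_smul, Matrix.trace_add, Matrix.trace_sub, Matrix.trace_one,
    Fintype.card_fin, smul_eq_mul, Matrix.trace_vecMulVec, hzz, hww, ← hηη]
  generalize η ⬝ᵥ η = K at *
  -- This cancellation dictates `γ` and `a`: `λ(γ+1) = Λn` and `a + γ = na` annihilate both the
  -- constant part and the part proportional to `K = |η|²`, so the `Ψ` terms contribute nothing.
  have h1 : lam * (γ * (γ + 1) * (1 + (a / γ) ^ 2 * K)) -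
      Lam * ((a + γ) * (n - 1) + a * (a + γ) / γ * K) = 0 := by
    have e1 : (a + γ) * (n - 1) = γ * n := by rw [add_mul, han]; ring
    have e2 : n * a = a + γ := by linarith
    have e3 : γ * (a / γ) ^ 2 = a * (a / γ) := by field_simp
    rw [e1, ← e2]
    have e4 : a * (n * a) / γ = n * (a * (a / γ)) := by ring
    rw [e4]
    linear_combination (γ + γ * (a / γ) ^ 2 * K) * hlγ + Lam * n * K * e3
  have h2 : 0 ≤ δ * (f / r ^ 2) * (lam * ((1 - C) * n)) := by
    have : 0 ≤ 1 - C := by linarith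
    positivity
  have h3 : lam * (f / r ^ 2 * (Ψ * (γ * (γ + 1)) * (1 + (a / γ) ^ 2 * K) +
        δ * (C * (2 * a - 1)) * K + δ * (1 - C) * n)) -
      Lam * (f / r ^ 2 * (Ψ * (a + γ) * (n - 1) + Ψ * (a * (a + γ) / γ) * K +
        δ * (2 * γ + 2 - C) * 1)) =
      δ * (f / r ^ 2) * (lam * (C * (2 * a - 1)) * K - Lam * (2 * γ + 2 - C)) +
      δ * (f / r ^ 2) * (lam * ((1 - C) * n)) := by
    linear_combination (f / r ^ 2 * Ψ) * h1
  rw [h3]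
  linarith

/-! ### Comparison with the barriers and lower bounds -/

theorem continuousOn_logBarrier {n : ℕ} (k : Fin n) (a b c₀ c₁ c₂ : ℝ) :
    ContinuousOn (logBarrier k a b c₀ c₁ c₂) {x | 0 < x k - 1} := by
  have h1 : ContinuousOn (fun x : EuclideanSpace ℝ (Fin n) => Real.log (x k - 1))
      {x | 0 < x k - 1} := ContinuousOn.log (by fun_prop) fun x hx => ne_of_gt hx
  have h2 : ContinuousOn (fun x : EuclideanSpace ℝ (Fin n) =>
      Real.log (dist x (EuclideanSpace.single k 1))) {x | 0 < x k - 1} :=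
    ContinuousOn.log (by fun_prop) fun x (hx : 0 < x k - 1) =>
      (hx.trans_le (coord_sub_le_dist_single k x)).ne'
  unfold logBarrier
  exact (Real.continuous_exp.comp_continuousOn
    ((continuousOn_const.mul h1).add (continuousOn_const.mul h2))).mul
    ((continuousOn_const.add (continuousOn_const.mul h1)).add (continuousOn_const.mul h2))

/-- Comparison with a barrier that decays at infinity and on the hyperplane `x k = 1`. -/
theorem IsViscositySupersolution.logBarrier_le {n : ℕ} {lam Lam : ℝ} {k : Fin n}
    (hk : (k : ℕ) + 1 = n) {g u : EuclideanSpace ℝ (Fin n) → ℝ}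
    (hu : IsViscositySupersolution (fun x M => pucciInf lam Lam M + g x) (upperHalfSpace n) u)
    (hpos : ∀ x ∈ upperHalfSpace n, 0 < u x) {a b c₀ c₁ c₂ b' M : ℝ} (ha : 0 < a) (hb' : a < b')
    (hM : 0 < M)
    (hdecay : ∀ x : EuclideanSpace ℝ (Fin n), 0 < x k - 1 →
      1 ≤ dist x (EuclideanSpace.single k 1) → logBarrier k a b c₀ c₁ c₂ x ≤
        M * Real.exp (a * Real.log (x k - 1)
          - b' * Real.log (dist x (EuclideanSpace.single k 1))))
    (hsphere : ∀ x : EuclideanSpace ℝ (Fin n), 0 < x k - 1 →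
      dist x (EuclideanSpace.single k 1) = 1 → logBarrier k a b c₀ c₁ c₂ x ≤ u x)
    (hsub : ∀ x : EuclideanSpace ℝ (Fin n), 0 < x k - 1 →
      1 < dist x (EuclideanSpace.single k 1) → 0 < logBarrier k a b c₀ c₁ c₂ x →
      ∃ G H, HasHessianAt (logBarrier k a b c₀ c₁ c₂) G H x ∧ 0 < pucciInf lam Lam H + g x)
    {x : EuclideanSpace ℝ (Fin n)} (hx : 0 < x k - 1)
    (hx1 : 1 ≤ dist x (EuclideanSpace.single k 1)) : logBarrier k a b c₀ c₁ c₂ x ≤ u x := by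
  by_contra hc
  rw [not_le] at hc
  set φ := logBarrier k a b c₀ c₁ c₂ with hφ
  set e : EuclideanSpace ℝ (Fin n) := EuclideanSpace.single k 1 with he
  have hΩ : ∀ y : EuclideanSpace ℝ (Fin n), 0 < y k - 1 → y ∈ upperHalfSpace n := fun y hy =>
    (mem_upperHalfSpace_iff hk).2 (by linarith)
  -- Since `log y ≤ log r` and `log r ≥ 0`, the exponent `a log y - b' log r` is at most `-κL` both
  -- near the plane (`log y ≤ -L`) and far away (`log r ≥ L`). Truncating there leaves a compact
  -- set.
  set κ := min a (b' - a) with hκ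
  have hκ0 : 0 < κ := lt_min ha (by linarith)
  have hη : 0 < φ x - u x := sub_pos.2 hc
  obtain ⟨L, hL0, hL⟩ : ∃ L : ℝ, 0 < L ∧ M * Real.exp (-(κ * L)) < φ x - u x := by
    have h1 : Filter.Tendsto (fun L : ℝ => M * Real.exp (-(κ * L))) Filter.atTop
        (nhds (M * 0)) := by
      refine Filter.Tendsto.const_mul _ (Real.tendsto_exp_neg_atTop_nhds_zero.comp ?_)
      exact Filter.tendsto_id.const_mul_atTop hκ0
    rw [mul_zero] at h1
    obtain ⟨L, h2, h3⟩ := ((Filter.eventually_gt_atTop (0 : ℝ)).and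
      (h1.eventually (gt_mem_nhds hη))).exists
    exact ⟨L, h2, h3⟩
  have hXY : ∀ y : EuclideanSpace ℝ (Fin n), 0 < y k - 1 →
      Real.log (y k - 1) ≤ Real.log (dist y e) := fun y hy =>
    Real.log_le_log hy (coord_sub_le_dist_single k y)
  have hsmall : ∀ y : EuclideanSpace ℝ (Fin n), 0 < y k - 1 → 1 ≤ dist y e →
      (Real.log (y k - 1) ≤ -L ∨ L ≤ Real.log (dist y e)) → φ y < φ x - u x := by
    intro y hy hy1 h
    refine ((hdecay y hy hy1).trans (mul_le_mul_of_nonneg_left (Real.exp_le_exp.2 ?_)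
      hM.le)).trans_lt hL
    have h1 := hXY y hy
    have h2 : 0 ≤ Real.log (dist y e) := Real.log_nonneg hy1
    have h3 : κ ≤ a := min_le_left _ _
    have h4 : κ ≤ b' - a := min_le_right _ _
    rcases h with h | h <;> nlinarith
  have hux : 0 < u x := hpos x (hΩ x hx)
  have hmem : ∀ y : EuclideanSpace ℝ (Fin n), Real.exp (-L) ≤ y k - 1 → 0 < y k - 1 := fun y hy =>
    (Real.exp_pos _).trans_le hy
  have hlogX : ∀ y : EuclideanSpace ℝ (Fin n), 0 < y k - 1 → y k - 1 ≤ Real.exp (-L) →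
      Real.log (y k - 1) ≤ -L := fun y hy h => by
    rw [← Real.log_exp (-L)]
    exact Real.log_le_log hy h
  have hlogY : ∀ y : EuclideanSpace ℝ (Fin n), Real.exp L ≤ dist y e →
      L ≤ Real.log (dist y e) := fun y h => by
    conv_lhs => rw [← Real.log_exp L]
    exact Real.log_le_log (Real.exp_pos _) h
  have hKc : IsCompact ((Metric.closedBall e (Real.exp L)) ∩
      {y | Real.exp (-L) ≤ y k - 1 ∧ 1 ≤ dist y e}) :=
    (isCompact_closedBall _ _).inter_right
      (IsClosed.inter (s₁ := {y : EuclideanSpace ℝ (Fin n) | Real.exp (-L) ≤ y k - 1})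
        (s₂ := {y : EuclideanSpace ℝ (Fin n) | 1 ≤ dist y e}) (isClosed_le continuous_const (by fun_prop))
        (isClosed_le continuous_const (by fun_prop)))
  obtain ⟨x₀, ⟨hx₀a, hx₀b, hx₀c⟩, hmin, hle⟩ := exists_isLocalMin_of_lt
    (U := Metric.ball e (Real.exp L) ∩ {y | Real.exp (-L) < y k - 1 ∧ 1 < dist y e})
    (w := fun y => u y - φ y) (x₁ := x) hKc
    (Metric.isOpen_ball.inter (IsOpen.inter
      (s := {y : EuclideanSpace ℝ (Fin n) | Real.exp (-L) < y k - 1})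
      (t := {y : EuclideanSpace ℝ (Fin n) | 1 < dist y e})
      (isOpen_lt continuous_const (by fun_prop)) (isOpen_lt continuous_const (by fun_prop))))
    (fun y hy => ⟨Metric.ball_subset_closedBall hy.1, hy.2.1.le, hy.2.2.le⟩)
    ((hu.1.mono fun y hy => hΩ y (hmem y hy.2.1)).sub
      ((continuousOn_logBarrier k a b c₀ c₁ c₂).mono fun y hy => hmem y hy.2.1))
    (by
      refine ⟨?_, ?_, hx1⟩
      · by_contra h
        rw [Metric.mem_closedBall, not_le] at h
        linarith [hsmall x hx hx1 (Or.inr (hlogY x h.le))]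
      · by_contra h
        rw [not_le] at h
        linarith [hsmall x hx hx1 (Or.inl (hlogX x hx h.le))])
    (by
      rintro y ⟨hy1, hy2, hy3⟩ hy
      have hy0 := hmem y hy2
      have huy := hpos y (hΩ y hy0)
      by_cases h1 : dist y e = 1
      · have := hsphere y hy0 h1
        linarith
      · have : φ y < φ x - u x := by
          refine hsmall y hy0 hy3 ?_
          by_contra h
          rw [not_or, not_le, not_le] at h
          refine hy ⟨?_, ?_, lt_of_le_of_ne hy3 (Ne.symm h1)⟩
          · by_contra h'
            exact absurd (hlogY y (not_lt.1 h')) (not_le.2 h.2)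
          · by_contra h'
            exact absurd (hlogX y hy0 (not_lt.1 h')) (not_le.2 h.1)
        linarith)
  have hx₀0 := hmem x₀ hx₀b.le
  -- At the minimum `φ` exceeds `u > 0`; the differential inequality for `φ` is only available where
  -- `φ` is positive.
  have hφ0 : 0 < φ x₀ := by
    have := hpos x₀ (hΩ x₀ hx₀0)
    linarith
  obtain ⟨G, H, hGH, hH⟩ := hsub x₀ hx₀0 hx₀c hφ0
  exact absurd (hu.le_of_hasHessianAt (hΩ x₀ hx₀0) hGH hmin) (not_le.2 hH)

/-- A positive supersolution decays at most like the explicit homogeneous subsolution. -/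
theorem IsViscositySupersolution.exists_mul_exp_le {n : ℕ} (hn : 2 ≤ n) {lam Lam : ℝ}
    (hlam : 0 < lam) (hLam : lam ≤ Lam) {k : Fin n} (hk : (k : ℕ) + 1 = n)
    {g u : EuclideanSpace ℝ (Fin n) → ℝ}
    (hu : IsViscositySupersolution (fun x M => pucciInf lam Lam M + g x) (upperHalfSpace n) u)
    (hpos : ∀ x ∈ upperHalfSpace n, 0 < u x) (hg : ∀ x ∈ upperHalfSpace n, 0 < g x)
    {a γ : ℝ} (hγ : γ = Lam * n / lam - 1) (ha : a = γ / (n - 1)) :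
    ∃ c > 0, ∀ x : EuclideanSpace ℝ (Fin n), 0 < x k - 1 →
      1 ≤ dist x (EuclideanSpace.single k 1) →
      c * Real.exp (a * Real.log (x k - 1)
        - (a + γ) * Real.log (dist x (EuclideanSpace.single k 1))) ≤ u x := by
  have hn' : (2 : ℝ) ≤ n := by exact_mod_cast hn
  have hlγ : lam * (γ + 1) = Lam * n := by rw [hγ]; field_simp; ring
  have hγn : (n : ℝ) - 1 ≤ γ := by nlinarith
  have hγ0 : 0 < γ := by linarith
  have ha0 : 0 < a := by rw [ha]; exact div_pos hγ0 (by linarith)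
  have hΩ : ∀ y : EuclideanSpace ℝ (Fin n), 0 ≤ y k - 1 → y ∈ upperHalfSpace n := fun y hy =>
    (mem_upperHalfSpace_iff hk).2 (by linarith)
  -- This closed half sphere, including its rim on `x k = 1`, lies inside the open half space, so
  -- `u` has a positive minimum on it.
  have hSc : IsCompact (Metric.sphere (EuclideanSpace.single k (1 : ℝ)) 1 ∩ {y | 0 ≤ y k - 1}) :=
    (isCompact_sphere _ _).inter_right (isClosed_le continuous_const (by fun_prop))
  have hne : (Metric.sphere (EuclideanSpace.single k (1 : ℝ)) 1 ∩ {y | 0 ≤ y k - 1}).Nonempty := by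
    refine ⟨EuclideanSpace.single k 1 + EuclideanSpace.single k 1, ?_, ?_⟩
    · simp
    · simp
  obtain ⟨y₀, hy₀, hmin⟩ := hSc.exists_isMinOn hne (hu.1.mono fun y hy => hΩ y hy.2)
  have hc0 : 0 < u y₀ := hpos y₀ (hΩ y₀ hy₀.2)
  have hval : ∀ x, logBarrier k a (a + γ) (u y₀) 0 0 x = u y₀ *
      Real.exp (a * Real.log (x k - 1)
        - (a + γ) * Real.log (dist x (EuclideanSpace.single k 1))) := fun x => by
    rw [logBarrier, mul_comm, neg_mul, ← sub_eq_add_neg]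
    simp
  refine ⟨u y₀, hc0, fun x hx hx1 => ?_⟩
  rw [← hval]
  refine hu.logBarrier_le hk hpos ha0 (b' := a + γ) (by linarith) hc0
    (fun y _ _ => (hval y).le) (fun y hy hy1 => ?_) (fun y hy hy1 _ => ?_) hx hx1
  · rw [hval, hy1, Real.log_one, mul_zero, sub_zero]
    have h1 : u y₀ ≤ u y := isMinOn_iff.1 hmin y ⟨hy1, hy.le⟩
    have h2 : Real.log (y k - 1) ≤ 0 :=
      Real.log_nonpos hy.le ((coord_sub_le_dist_single k y).trans hy1.le)
    have h3 : Real.exp (a * Real.log (y k - 1)) ≤ 1 :=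
      Real.exp_le_one_iff.2 (mul_nonpos_of_nonneg_of_nonpos ha0.le h2)
    exact (mul_le_of_le_one_right hc0.le h3).trans h1
  -- For `δ = 0` the barrier is purely homogeneous and Pucci's operator is only known to be
  -- nonnegative on it; strictness comes from the source `g > 0`.
  · obtain ⟨G, H, h1, h2⟩ := logBarrier_le_pucciInf hn hlam hLam k hγ ha
      (C := a / (γ + 1)) (by field_simp) (c₀ := u y₀) (δ := 0) le_rfl hy (by simpa using hc0.le)
    simp only [zero_mul] at h1 h2
    exact ⟨G, H, h1, by linarith [hg y (hΩ y hy.le)]⟩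

/-- The logarithmic improvement at the critical exponent. -/
theorem IsViscositySupersolution.exists_mul_log_le {n : ℕ} (hn : 2 ≤ n) {lam Lam : ℝ}
    (hlam : 0 < lam) (hLam : lam ≤ Lam) {k : Fin n} (hk : (k : ℕ) + 1 = n)
    {u v : EuclideanSpace ℝ (Fin n) → ℝ} {p : ℝ} (hp0 : 0 < p)
    (hu : IsViscositySupersolution (fun x M => pucciInf lam Lam M + v x ^ p)
      (upperHalfSpace n) u)
    (hpos : ∀ x ∈ upperHalfSpace n, 0 < u x)
    {a γ : ℝ} (hγ : γ = Lam * n / lam - 1) (ha : a = γ / (n - 1)) (hp : γ * (p - 1) = 2)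
    {c : ℝ} (hc : 0 < c)
    (hv : ∀ x : EuclideanSpace ℝ (Fin n), 0 < x k - 1 →
      1 ≤ dist x (EuclideanSpace.single k 1) →
      c * Real.exp (a * Real.log (x k - 1)
        - (a + γ) * Real.log (dist x (EuclideanSpace.single k 1))) ≤ v x) :
    ∃ δ > 0, ∀ x : EuclideanSpace ℝ (Fin n), 1 ≤ x k - 1 →
      δ * (Real.exp (a * Real.log (x k - 1)
        - (a + γ) * Real.log (dist x (EuclideanSpace.single k 1))) * Real.log (x k - 1))
        ≤ u x := by
  have hn' : (2 : ℝ) ≤ n := by exact_mod_cast hn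
  have hLam0 : 0 < Lam := hlam.trans_le hLam
  have hlγ : lam * (γ + 1) = Lam * n := by rw [hγ]; field_simp; ring
  have hγn : (n : ℝ) - 1 ≤ γ := by nlinarith
  have hγ0 : 0 < γ := by linarith
  have han : a * (n - 1) = γ := by
    rw [ha, div_mul_cancel₀]
    linarith
  have ha1 : 1 ≤ a := by nlinarith
  have haγ : a ≤ γ := by nlinarith
  obtain ⟨C, hC⟩ : ∃ C, C * (γ + 1) = a := ⟨a / (γ + 1), by field_simp⟩
  have hC0 : 0 < C := by
    by_contra h
    nlinarith
  have hC1 : C ≤ 1 := by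
    by_contra h
    nlinarith
  have hap : a * (p - 1) ≤ 2 := by
    have : 0 < p - 1 := by
      by_contra h
      nlinarith
    nlinarith
  obtain ⟨κ₁, hκ₁⟩ : ∃ κ₁, κ₁ = lam * (C * (2 * a - 1)) := ⟨_, rfl⟩
  obtain ⟨κ₂, hκ₂⟩ : ∃ κ₂, κ₂ = Lam * (2 * γ + 2 - C) := ⟨_, rfl⟩
  have hκ₁0 : 0 < κ₁ := hκ₁ ▸ mul_pos hlam (mul_pos hC0 (by linarith))
  have hκ₂0 : 0 < κ₂ := hκ₂ ▸ mul_pos hLam0 (by linarith)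
  have hcp : 0 < c ^ p := Real.rpow_pos_of_pos hc p
  -- Chosen so that `κ₁ · (c^p/δ) = (κ₁ + κ₂)²`, as the final arithmetic-geometric mean argument
  -- requires.
  obtain ⟨δ, hδ⟩ : ∃ δ, δ = κ₁ * c ^ p / (κ₁ + κ₂) ^ 2 := ⟨_, rfl⟩
  have hδ0 : 0 < δ := by rw [hδ]; positivity
  have hΩ : ∀ y : EuclideanSpace ℝ (Fin n), 0 < y k - 1 → y ∈ upperHalfSpace n := fun y hy =>
    (mem_upperHalfSpace_iff hk).2 (by linarith)
  have hXY : ∀ y : EuclideanSpace ℝ (Fin n), 0 < y k - 1 →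
      Real.log (y k - 1) ≤ Real.log (dist y (EuclideanSpace.single k 1)) := fun y hy =>
    Real.log_le_log hy (coord_sub_le_dist_single k y)
  have hmain : ∀ x : EuclideanSpace ℝ (Fin n), 0 < x k - 1 →
      1 ≤ dist x (EuclideanSpace.single k 1) →
      logBarrier k a (a + γ) 0 (δ * C) (δ * (1 - C)) x ≤ u x := by
    intro x hx hx1
    -- Half of the decay `γ` is given up to absorb the logarithm, through `Y ≤ (2/γ) exp(γY/2)`.
    refine hu.logBarrier_le hk hpos (by linarith) (b' := a + γ / 2) (M := δ * (2 / γ))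
      (by linarith) (by positivity) (fun y hy hy1 => ?_) (fun y hy hy1 => ?_)
      (fun y hy hy1 hφ => ?_) hx hx1
    · have hXYy := hXY y hy
      rw [logBarrier]
      have hY : 0 ≤ Real.log (dist y (EuclideanSpace.single k 1)) := Real.log_nonneg hy1
      set X := Real.log (y k - 1)
      set Y := Real.log (dist y (EuclideanSpace.single k 1))
      have h1 : Y ≤ 2 / γ * Real.exp (γ / 2 * Y) := by
        have h := Real.add_one_le_exp (γ / 2 * Y)
        have h' : Y = 2 / γ * (γ / 2 * Y) := by field_simp
        calc Y = 2 / γ * (γ / 2 * Y) := h'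
          _ ≤ 2 / γ * Real.exp (γ / 2 * Y) := by gcongr; linarith
      have h2 : (0 + δ * C * X) + δ * (1 - C) * Y ≤ δ * Y := by
        have := mul_le_mul_of_nonneg_left hXYy (mul_pos hδ0 hC0).le
        linarith
      have h3 : Real.exp (a * X - (a + γ / 2) * Y) =
          Real.exp (a * X + -(a + γ) * Y) * Real.exp (γ / 2 * Y) := by
        rw [← Real.exp_add]
        ring_nf
      rw [h3]
      calc Real.exp (a * X + -(a + γ) * Y) * ((0 + δ * C * X) + δ * (1 - C) * Y)
          ≤ Real.exp (a * X + -(a + γ) * Y) * (δ * (2 / γ * Real.exp (γ / 2 * Y))) := by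
            refine mul_le_mul_of_nonneg_left (h2.trans ?_) (Real.exp_pos _).le
            exact mul_le_mul_of_nonneg_left h1 hδ0.le
        _ = _ := by ring
    · refine le_trans ?_ (hpos y (hΩ y hy)).le
      rw [logBarrier, hy1, Real.log_one, mul_zero, mul_zero, zero_add, add_zero, add_zero]
      refine mul_nonpos_of_nonneg_of_nonpos (Real.exp_pos _).le ?_
      exact mul_nonpos_of_nonneg_of_nonpos (by positivity)
        (Real.log_nonpos hy.le ((coord_sub_le_dist_single k y).trans hy1.le))
    · have hΨ := pos_of_mul_pos_right hφ (Real.exp_pos _).le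
      obtain ⟨G, H, h1, h2⟩ := logBarrier_le_pucciInf hn hlam hLam k hγ ha hC hδ0.le hy hΨ.le
      refine ⟨G, H, h1, ?_⟩
      have hXYy := hXY y hy
      have hvy := hv y hy hy1.le
      have hr0 : 0 < dist y (EuclideanSpace.single k 1) := by linarith
      rw [← hκ₁, ← hκ₂] at h2
      set r := dist y (EuclideanSpace.single k 1) with hr
      set X := Real.log (y k - 1) with hXd
      set Y := Real.log r with hYd
      have eX : Real.exp X = y k - 1 := Real.exp_log hy
      have eY : Real.exp Y = r := Real.exp_log hr0
      obtain ⟨f, hf⟩ : ∃ f, f = Real.exp (a * X - (a + γ) * Y) := ⟨_, rfl⟩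
      have hf0 : 0 < f := hf ▸ Real.exp_pos _
      rw [neg_mul, ← sub_eq_add_neg, ← hf] at h2
      rw [← hf] at hvy
      obtain ⟨Z, hZ⟩ : ∃ Z, Z = (y k - 1) ^ 2 / r ^ 2 := ⟨_, rfl⟩
      have hZ0 : 0 < Z := by rw [hZ]; positivity
      have hZi : r ^ 2 / (y k - 1) ^ 2 = Z⁻¹ := by rw [hZ, inv_div]
      -- By criticality `f^(p-1) = (y/r)^(a(p-1)) r^(-2)`; since `a(p-1) ≤ γ(p-1) = 2` and `y ≤ r`,
      -- this is at least `Z r^(-2)`.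
      have h3 : c ^ p * (f / r ^ 2 * Z) ≤ v y ^ p := by
        refine le_trans ?_ (Real.rpow_le_rpow (mul_pos hc hf0).le hvy hp0.le)
        rw [Real.mul_rpow hc.le hf0.le]
        refine mul_le_mul_of_nonneg_left ?_ hcp.le
        have e1 : f / r ^ 2 * Z = Real.exp (a * X - (a + γ) * Y + 2 * X - 4 * Y) := by
          rw [hZ, hf, ← eX, ← eY, Real.exp_sub (_ + _), Real.exp_add,
            show (4 : ℝ) * Y = Y + Y + Y + Y by ring, two_mul X]
          simp only [Real.exp_add]
          field_simp
        rw [e1, hf, ← Real.exp_mul]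
        refine Real.exp_le_exp.2 ?_
        have h := mul_nonneg (sub_nonneg.2 hap) (sub_nonneg.2 hXYy)
        have e2 : (a * X - (a + γ) * Y) * p - (a * X - (a + γ) * Y + 2 * X - 4 * Y) =
            (2 - a * (p - 1)) * (Y - X) := by
          linear_combination (-Y) * hp
        linarith
      -- The gain `κ₁/Z` dominates near the plane and the source, proportional to `Z`, away from it;
      -- by arithmetic-geometric means their sum is at least `2(κ₁ + κ₂)`.
      have h4 : 0 < κ₁ * (Z⁻¹ - 1) - κ₂ + c ^ p / δ * Z := by
        have e1 : c ^ p / δ = (κ₁ + κ₂) ^ 2 / κ₁ := by rw [hδ]; field_simp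
        rw [e1]
        have e2 : κ₁ * (Z⁻¹ - 1) - κ₂ + (κ₁ + κ₂) ^ 2 / κ₁ * Z =
            ((κ₁ - (κ₁ + κ₂) * Z) ^ 2 + (κ₁ + κ₂) * κ₁ * Z) / (κ₁ * Z) := by
          field_simp
          ring
        rw [e2]
        positivity
      have h5 : 0 < δ * (f / r ^ 2) * (κ₁ * (Z⁻¹ - 1) - κ₂ + c ^ p / δ * Z) := by positivity
      have h6 : δ * (f / r ^ 2) * (κ₁ * (Z⁻¹ - 1) - κ₂ + c ^ p / δ * Z) =
          δ * (f / r ^ 2) * (κ₁ * (Z⁻¹ - 1) - κ₂) + c ^ p * (f / r ^ 2 * Z) := by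
        field_simp
      rw [hZi] at h2
      linarith
  refine ⟨δ, hδ0, fun x hx => ?_⟩
  have hx0 : 0 < x k - 1 := by linarith
  refine le_trans ?_ (hmain x hx0 (hx.trans (coord_sub_le_dist_single k x)))
  have h := hXY x hx0
  rw [logBarrier, neg_mul, ← sub_eq_add_neg, mul_left_comm]
  refine mul_le_mul_of_nonneg_left ?_ (Real.exp_pos _).le
  have := mul_le_mul_of_nonneg_left h (mul_nonneg hδ0.le (sub_nonneg.2 hC1))
  linarith

/-! ### The scale-invariant upper bound -/

/-- Positive solutions of the system are comparable on concentric balls of radius `R` centred at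
height `2 R`, with a constant independent of the scale. -/
theorem IsViscositySupersolution.exists_rpow_le {n : ℕ} (hn : 0 < n) {lam Lam : ℝ}
    (hlam : 0 < lam) (hLam : lam ≤ Lam) {k : Fin n} (hk : (k : ℕ) + 1 = n) {p : ℝ} (hp : 0 < p)
    {g u v : EuclideanSpace ℝ (Fin n) → ℝ}
    (hu : IsViscositySupersolution (fun x M => pucciInf lam Lam M + v x ^ p)
      (upperHalfSpace n) u)
    (hv : IsViscositySupersolution (fun x M => pucciInf lam Lam M + g x) (upperHalfSpace n) v)
    (hupos : ∀ x ∈ upperHalfSpace n, 0 < u x) (hvpos : ∀ x ∈ upperHalfSpace n, 0 < v x)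
    (hg : ∀ x ∈ upperHalfSpace n, 0 ≤ g x) :
    ∃ K > 0, ∀ R > 0, ∀ m > 0, ∀ y ∈ Metric.closedBall (EuclideanSpace.single k (2 * R)) (R / 8),
      (∀ x ∈ Metric.closedBall (EuclideanSpace.single k (2 * R)) (R / 8), m ≤ v x) →
      m ^ p ≤ K * u y / R ^ 2 := by
  have hn' : (0 : ℝ) < n := by exact_mod_cast hn
  have hLam0 : 0 < Lam := hlam.trans_le hLam
  set α : ℝ := Lam * n / lam with hα
  have hα0 : 0 < α := by positivity
  -- Up to the factor `(R²)^(-α)`, `N` and `D` are the radial barrier at distances `5R/8` and `R/8`,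
  -- normalised to vanish at `R`. Their ratio `θ` is thus independent of `R`. The distance `5R/8 =
  -- R/2 + R/8` bounds how far the paraboloid ball about `y` reaches from `z`.
  set N : ℝ := ((5 / 8 : ℝ) ^ 2 / 2) ^ (-α) - ((1 : ℝ) / 2) ^ (-α) with hN
  set D : ℝ := ((1 / 8 : ℝ) ^ 2 / 2) ^ (-α) - ((1 : ℝ) / 2) ^ (-α) with hD
  have hN0 : 0 < N :=
    sub_pos.2 (Real.rpow_lt_rpow_of_neg (by norm_num) (by norm_num) (by linarith))
  have hND : N < D :=
    sub_lt_sub_right (Real.rpow_lt_rpow_of_neg (by norm_num) (by norm_num) (by linarith)) _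
  have hD0 : 0 < D := hN0.trans hND
  set θ := N / D with hθ
  have hθ0 : 0 < θ := div_pos hN0 hD0
  have hθ1 : θ ≤ 1 := (div_le_one hD0).2 hND.le
  have hθp : 0 < θ ^ p := Real.rpow_pos_of_pos hθ0 p
  refine ⟨16 * Lam * n / θ ^ p, by positivity, fun R hR m hm y hy hmv => ?_⟩
  set z : EuclideanSpace ℝ (Fin n) := EuclideanSpace.single k (2 * R) with hz
  have hball : Metric.closedBall z R ⊆ upperHalfSpace n :=
    closedBall_subset_upperHalfSpace hk (by simp [hz]; linarith)
  have hyd := Metric.mem_closedBall.1 hy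
  obtain ⟨x, hx, hxv⟩ := hu.exists_le_of_closedBall_subset hLam hupos (y := y) (R := R / 2)
    (by positivity) ((Metric.closedBall_subset_closedBall' (by linarith)).trans hball)
  have hxz : dist x z ≤ 5 / 8 * R := by
    have := dist_triangle x y z
    have := Metric.mem_closedBall.1 hx
    linarith
  have key : θ * m ≤ v x := by
    rcases le_or_gt (dist x z) (R / 8) with h | h
    · exact (mul_le_of_le_one_left hm.le hθ1).trans (hmv x h)
    · have h1 := hv.annulus_le hn hlam hLam (fun x hx => (hvpos x hx).le) hg (ρ := R / 8) (R := R)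
        (by positivity) (by linarith) hm hball
        (fun x hx => hmv x (Metric.sphere_subset_closedBall hx)) h.le (by linarith)
      refine le_trans ?_ h1
      rw [mul_comm]
      refine mul_le_mul_of_nonneg_left ?_ hm.le
      have e : ∀ t : ℝ, 0 < t → ((t * R) ^ 2 / 2) ^ (-α) = (R ^ 2) ^ (-α) * (t ^ 2 / 2) ^ (-α) :=
        fun t ht => by
          rw [← Real.mul_rpow (by positivity) (by positivity)]
          ring_nf
      have e1 : (R ^ 2 / 2) ^ (-α) = (R ^ 2) ^ (-α) * ((1 : ℝ) / 2) ^ (-α) := by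
        simpa using e 1 one_pos
      have e2 : ((R / 8) ^ 2 / 2) ^ (-α) = (R ^ 2) ^ (-α) * ((1 / 8 : ℝ) ^ 2 / 2) ^ (-α) := by
        rw [← e _ (by norm_num)]
        ring_nf
      have hR2 : 0 < (R ^ 2) ^ (-α) := Real.rpow_pos_of_pos (by positivity) _
      have h3 : (R ^ 2) ^ (-α) * ((5 / 8 : ℝ) ^ 2 / 2) ^ (-α) ≤ (dist x z ^ 2 / 2) ^ (-α) := by
        rw [← e _ (by norm_num)]
        have hd : 0 < dist x z := lt_trans (by positivity) h
        refine Real.rpow_le_rpow_of_nonpos (by positivity) ?_ (by linarith)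
        gcongr
      rw [e1, e2, ← mul_sub, ← hD, hθ, div_le_div_iff₀ hD0 (by positivity), hN]
      nlinarith
  have h4 : θ ^ p * m ^ p ≤ v x ^ p := by
    rw [← Real.mul_rpow hθ0.le hm.le]
    exact Real.rpow_le_rpow (by positivity) key hp.le
  have h5 : 16 * Lam * n / θ ^ p * u y / R ^ 2 = (4 * Lam * n * u y / (R / 2) ^ 2) / θ ^ p := by
    field_simp
    ring
  rw [h5, le_div_iff₀ hθp, mul_comm]
  exact h4.trans hxv

/-- The upper bound for the first component of a positive supersolution of the system, in
logarithmic form. -/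
theorem exists_log_upper_bound {n : ℕ} (hn : 0 < n) {lam Lam : ℝ}
    (hlam : 0 < lam) (hLam : lam ≤ Lam) {k : Fin n} (hk : (k : ℕ) + 1 = n) {p q : ℝ} (hp : 0 < p)
    (hq : 0 < q) {u v : EuclideanSpace ℝ (Fin n) → ℝ}
    (hu : IsViscositySupersolution (fun x M => pucciInf lam Lam M + v x ^ p)
      (upperHalfSpace n) u)
    (hv : IsViscositySupersolution (fun x M => pucciInf lam Lam M + u x ^ q)
      (upperHalfSpace n) v)
    (hupos : ∀ x ∈ upperHalfSpace n, 0 < u x) (hvpos : ∀ x ∈ upperHalfSpace n, 0 < v x) :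
    ∃ K, ∀ R > 0, ∃ y ∈ Metric.closedBall (EuclideanSpace.single k (2 * R)) (R / 8),
      (p * q - 1) * Real.log (u y) ≤ K - 2 * (p + 1) * Real.log R := by
  obtain ⟨K₁, hK₁, h₁⟩ := hu.exists_rpow_le hn hlam hLam hk hp hv hupos hvpos
    fun x hx => Real.rpow_nonneg (hupos x hx).le _
  obtain ⟨K₂, hK₂, h₂⟩ := hv.exists_rpow_le hn hlam hLam hk hq hu hvpos hupos
    fun x hx => Real.rpow_nonneg (hvpos x hx).le _
  refine ⟨Real.log K₁ + p * Real.log K₂, fun R hR => ?_⟩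
  set B := Metric.closedBall (EuclideanSpace.single k (2 * R)) (R / 8) with hB
  have hBΩ : B ⊆ upperHalfSpace n :=
    closedBall_subset_upperHalfSpace hk (by simp; linarith)
  have hBc : IsCompact B := isCompact_closedBall _ _
  have hBn : B.Nonempty := ⟨_, Metric.mem_closedBall_self (by positivity)⟩
  obtain ⟨y, hy, hymin⟩ := hBc.exists_isMinOn hBn (hu.1.mono hBΩ)
  obtain ⟨y', hy', hymin'⟩ := hBc.exists_isMinOn hBn (hv.1.mono hBΩ)
  have hu0 := hupos y (hBΩ hy)
  have hv0 := hvpos y' (hBΩ hy')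
  have i₁ := Real.log_le_log (by positivity) (h₁ R hR _ hv0 y hy (isMinOn_iff.1 hymin'))
  have i₂ := Real.log_le_log (by positivity) (h₂ R hR _ hu0 y' hy' (isMinOn_iff.1 hymin))
  rw [Real.log_rpow (by positivity), Real.log_div (by positivity) (by positivity),
    Real.log_mul (by positivity) (by positivity), Real.log_pow] at i₁ i₂
  refine ⟨y, hy, ?_⟩
  -- Adding `p` times the second logarithmic inequality to the first eliminates `log (v y')`.
  have := mul_le_mul_of_nonneg_left i₂ hp.le
  push_cast at *
  linarith

/-! ### The upper and lower bounds contradict each other -/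

theorem le_coord_and_dist_le_of_mem_closedBall {n : ℕ} {k : Fin n} {R : ℝ} (hR : 8 ≤ R)
    {y : EuclideanSpace ℝ (Fin n)}
    (hy : y ∈ Metric.closedBall (EuclideanSpace.single k (2 * R)) (R / 8)) :
    R ≤ y k - 1 ∧ dist y (EuclideanSpace.single k 1) ≤ 3 * R := by
  have hyd := Metric.mem_closedBall.1 hy
  have h1 := (abs_le.1 ((abs_apply_sub_le_dist y _ k).trans hyd)).1
  have h2 := dist_triangle y (EuclideanSpace.single k (2 * R)) (EuclideanSpace.single k 1)
  have h3 : dist (EuclideanSpace.single k (2 * R)) (EuclideanSpace.single k (1 : ℝ)) =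
      2 * R - 1 := by
    rw [PiLp.dist_single_same, Real.dist_eq, abs_of_nonneg (by linarith)]
  simp only [PiLp.single_apply, if_true] at h1
  exact ⟨by linarith, by linarith⟩

theorem log_barrier_lower_bound {n : ℕ} {k : Fin n} {R a γ : ℝ} (hR : 8 ≤ R) (ha : 0 < a) (hγ : 0 < γ)
    {y : EuclideanSpace ℝ (Fin n)}
    (hy : y ∈ Metric.closedBall (EuclideanSpace.single k (2 * R)) (R / 8)) :
    -(a + γ) * Real.log 3 - γ * Real.log R ≤ a * Real.log (y k - 1)
        - (a + γ) * Real.log (dist y (EuclideanSpace.single k 1)) := by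
  obtain ⟨h1, h2⟩ := le_coord_and_dist_le_of_mem_closedBall hR hy
  have h3 : Real.log R ≤ Real.log (y k - 1) := Real.log_le_log (by linarith) h1
  have h4 : Real.log (dist y (EuclideanSpace.single k 1)) ≤ Real.log 3 + Real.log R := by
    rw [← Real.log_mul (by norm_num) (by linarith)]
    exact Real.log_le_log (by linarith [coord_sub_le_dist_single k y]) h2
  nlinarith [mul_le_mul_of_nonneg_left h3 ha.le, mul_le_mul_of_nonneg_left h4 (add_pos ha hγ).le]

/-- There is no positive supersolution in the subcritical range. -/
theorem no_pos_supersolution_of_lt {n : ℕ} (hn : 2 ≤ n) {lam Lam : ℝ}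
    (hlam : 0 < lam) (hLam : lam ≤ Lam) {p q : ℝ} (hp : 0 < p) (hq : 0 < q) (hpq : 1 ≤ p * q)
    (hsub : (Lam * n / lam - 1) * (p * q - 1) < 2 * (p + 1))
    {u v : EuclideanSpace ℝ (Fin n) → ℝ}
    (hu : IsViscositySupersolution (fun x M => pucciInf lam Lam M + v x ^ p)
      (upperHalfSpace n) u)
    (hv : IsViscositySupersolution (fun x M => pucciInf lam Lam M + u x ^ q)
      (upperHalfSpace n) v)
    (hupos : ∀ x ∈ upperHalfSpace n, 0 < u x) (hvpos : ∀ x ∈ upperHalfSpace n, 0 < v x) :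
    False := by
  obtain ⟨k, hk⟩ : ∃ k : Fin n, (k : ℕ) + 1 = n := ⟨⟨n - 1, by omega⟩, by simp; omega⟩
  obtain ⟨γ, hγ⟩ : ∃ γ, γ = Lam * n / lam - 1 := ⟨_, rfl⟩
  obtain ⟨a, ha⟩ : ∃ a, a = γ / (n - 1) := ⟨_, rfl⟩
  have hn' : (2 : ℝ) ≤ n := by exact_mod_cast hn
  have hlγ : lam * (γ + 1) = Lam * n := by rw [hγ]; field_simp; ring
  have hγ0 : 0 < γ := by nlinarith
  have ha0 : 0 < a := by rw [ha]; exact div_pos hγ0 (by linarith)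
  obtain ⟨c, hc, hlow⟩ := hu.exists_mul_exp_le hn hlam hLam hk hupos
    (fun x hx => Real.rpow_pos_of_pos (hvpos x hx) p) hγ ha
  obtain ⟨K, hK⟩ := exists_log_upper_bound (by omega) hlam hLam hk hp hq hu hv hupos hvpos
  rw [← hγ] at hsub
  -- After the lower bound is multiplied by `pq - 1 ≥ 0`, this is the gap between the two bounds up
  -- to constants.
  have htend : Filter.Tendsto (fun R => (2 * (p + 1) - γ * (p * q - 1)) * Real.log R)
      Filter.atTop Filter.atTop := Real.tendsto_log_atTop.const_mul_atTop (by linarith)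
  obtain ⟨R, hR, hRK⟩ := ((Filter.eventually_ge_atTop (8 : ℝ)).and
    (htend.eventually_gt_atTop
      (K - (p * q - 1) * (Real.log c - (a + γ) * Real.log 3)))).exists
  obtain ⟨y, hy, hyK⟩ := hK R (by linarith)
  obtain ⟨h1, -⟩ := le_coord_and_dist_le_of_mem_closedBall hR hy
  have h2 := hlow y (by linarith) (le_trans (by linarith) (coord_sub_le_dist_single k y))
  have h3 := Real.log_le_log (by positivity) h2
  rw [Real.log_mul hc.ne' (Real.exp_pos _).ne', Real.log_exp] at h3
  have h4 := log_barrier_lower_bound hR ha0 hγ0 hy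
  have h5 := mul_le_mul_of_nonneg_left (h4.trans (le_sub_iff_add_le'.2 h3))
    (sub_nonneg.2 hpq)
  linarith

/-- There is no positive supersolution at the critical exponent. -/
theorem no_pos_supersolution_of_eq {n : ℕ} (hn : 2 ≤ n) {lam Lam : ℝ}
    (hlam : 0 < lam) (hLam : lam ≤ Lam) {p : ℝ} (hp : 0 < p)
    (hcrit : (Lam * n / lam - 1) * (p - 1) = 2)
    {u v : EuclideanSpace ℝ (Fin n) → ℝ}
    (hu : IsViscositySupersolution (fun x M => pucciInf lam Lam M + v x ^ p)
      (upperHalfSpace n) u)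
    (hv : IsViscositySupersolution (fun x M => pucciInf lam Lam M + u x ^ p)
      (upperHalfSpace n) v)
    (hupos : ∀ x ∈ upperHalfSpace n, 0 < u x) (hvpos : ∀ x ∈ upperHalfSpace n, 0 < v x) :
    False := by
  obtain ⟨k, hk⟩ : ∃ k : Fin n, (k : ℕ) + 1 = n := ⟨⟨n - 1, by omega⟩, by simp; omega⟩
  obtain ⟨γ, hγ⟩ : ∃ γ, γ = Lam * n / lam - 1 := ⟨_, rfl⟩
  obtain ⟨a, ha⟩ : ∃ a, a = γ / (n - 1) := ⟨_, rfl⟩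
  have hn' : (2 : ℝ) ≤ n := by exact_mod_cast hn
  have hlγ : lam * (γ + 1) = Lam * n := by rw [hγ]; field_simp; ring
  have hγ0 : 0 < γ := by nlinarith
  have ha0 : 0 < a := by rw [ha]; exact div_pos hγ0 (by linarith)
  rw [← hγ] at hcrit
  have hp1 : 0 < p - 1 := by
    by_contra h
    nlinarith
  have hpp : 0 < p * p - 1 := by nlinarith
  obtain ⟨c, hc, hlow⟩ := hv.exists_mul_exp_le hn hlam hLam hk hvpos
    (fun x hx => Real.rpow_pos_of_pos (hupos x hx) p) hγ ha
  obtain ⟨δ, hδ, hlog⟩ := hu.exists_mul_log_le hn hlam hLam hk hp hupos hγ ha hcrit hc hlow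
  obtain ⟨K, hK⟩ := exists_log_upper_bound (by omega) hlam hLam hk hp hp hu hv hupos hvpos
  -- At criticality the `log R` terms cancel, and only the iterated logarithm from the improved
  -- barrier remains.
  have htend : Filter.Tendsto (fun R => (p * p - 1) * Real.log (Real.log R))
      Filter.atTop Filter.atTop :=
    (Real.tendsto_log_atTop.comp Real.tendsto_log_atTop).const_mul_atTop hpp
  obtain ⟨R, hR, hRK⟩ := ((Filter.eventually_ge_atTop (8 : ℝ)).and
    (htend.eventually_gt_atTop
      (K - (p * p - 1) * (Real.log δ - (a + γ) * Real.log 3)))).exists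
  obtain ⟨y, hy, hyK⟩ := hK R (by linarith)
  obtain ⟨h1, -⟩ := le_coord_and_dist_le_of_mem_closedBall hR hy
  have hlR : 0 < Real.log R := Real.log_pos (by linarith)
  have hlR' : Real.log R ≤ Real.log (y k - 1) := Real.log_le_log (by linarith) h1
  have hly : 0 < Real.log (y k - 1) := hlR.trans_le hlR'
  have h2 := hlog y (by linarith)
  have h3 := Real.log_le_log (by positivity) h2
  rw [Real.log_mul hδ.ne' (by positivity), Real.log_mul (Real.exp_pos _).ne' hly.ne',
    Real.log_exp] at h3
  have h4 := log_barrier_lower_bound hR ha0 hγ0 hy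
  have h5 : Real.log (Real.log R) ≤ Real.log (Real.log (y k - 1)) := Real.log_le_log hlR hlR'
  have h6 : Real.log δ - (a + γ) * Real.log 3 - γ * Real.log R + Real.log (Real.log R) ≤
      Real.log (u y) := by linarith
  have h7 := mul_le_mul_of_nonneg_left h6 hpp.le
  have h8 : γ * (p * p - 1) = 2 * (p + 1) := by linear_combination (p + 1) * hcrit
  have h9 : (p * p - 1) * (γ * Real.log R) = 2 * (p + 1) * Real.log R := by rw [← h8]; ring
  linarith

/-! ### The zero pair is a supersolution -/

open Filter Topology in
/-- Second order necessary condition at a local maximum. -/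
theorem fderiv_fderiv_apply_nonpos_of_isLocalMax {n : ℕ} {φ : EuclideanSpace ℝ (Fin n) → ℝ}
    {x : EuclideanSpace ℝ (Fin n)} (hφ : ContDiffAt ℝ 2 φ x) (hmax : IsLocalMax φ x)
    (V : EuclideanSpace ℝ (Fin n)) : fderiv ℝ (fderiv ℝ φ) x V V ≤ 0 := by
  by_contra hc
  rw [not_le] at hc
  set L : ℝ → EuclideanSpace ℝ (Fin n) := fun t => x + t • V with hL
  have hL0 : L 0 = x := by simp [hL]
  have hLd : ∀ t, HasDerivAt L V t := fun t => by
    have h := ((hasDerivAt_id t).smul_const V).const_add x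
    rw [one_smul] at h
    exact h
  have hLt : Tendsto L (𝓝 0) (𝓝 x) := by
    have := (hLd 0).continuousAt.tendsto
    rwa [hL0] at this
  have h1 : deriv (fun t => φ (L t)) =ᶠ[𝓝 0] fun t => fderiv ℝ φ (L t) V := by
    filter_upwards [hLt.eventually (contDiffAt_two_eventually_differentiableAt hφ)] with t ht
    exact (ht.hasFDerivAt.comp_hasDerivAt t (hLd t)).deriv
  have h2 : deriv (deriv fun t => φ (L t)) 0 = fderiv ℝ (fderiv ℝ φ) x V V := by
    rw [h1.deriv_eq]
    have hd : HasFDerivAt (fderiv ℝ φ) (fderiv ℝ (fderiv ℝ φ) x) (L 0) := by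
      rw [hL0]
      exact hφ.differentiableAt_fderiv_two.hasFDerivAt
    have := (hd.comp_hasDerivAt (0 : ℝ) (hLd 0)).clm_apply (hasDerivAt_const (0 : ℝ) V)
    simpa using this.deriv
  have hmaxg : IsLocalMax (fun t => φ (L t)) 0 := by
    have h : ∀ᶠ t in 𝓝 (0 : ℝ), φ (L t) ≤ φ x := hLt.eventually hmax
    filter_upwards [h] with t ht
    rwa [hL0]
  have hcont : ContinuousAt (fun t => φ (L t)) 0 := by
    have : ContinuousAt φ (L 0) := by rw [hL0]; exact hφ.continuousAt
    exact ContinuousAt.comp this (hLd 0).continuousAt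
  -- A positive second derivative would make `0` a local minimum as well as a maximum, so the
  -- function would be locally constant along the line, with zero second derivative.
  have hming := isLocalMin_of_deriv_deriv_pos (by rw [h2]; exact hc) hmaxg.deriv_eq_zero hcont
  have h3 : (fun t => φ (L t)) =ᶠ[𝓝 0] fun _ => φ (L 0) := by
    filter_upwards [hmaxg, hming] with t h h' using le_antisymm h h'
  have h4 := h3.deriv.deriv_eq
  rw [h2] at h4
  simp at h4
  linarith

theorem pucciInf_hessian_nonpos_of_isLocalMax {n : ℕ} {lam Lam : ℝ} (hlam : 0 < lam)
    (hLam : lam ≤ Lam) {φ : EuclideanSpace ℝ (Fin n) → ℝ}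
    {x : EuclideanSpace ℝ (Fin n)} (hφ : ContDiffAt ℝ 2 φ x) (hmax : IsLocalMax φ x) :
    pucciInf lam Lam (hessian φ x) ≤ 0 := by
  have hM := hessian_isHermitian_of_contDiffAt hφ
  have hev : ∀ i, hM.eigenvalues i ≤ 0 := by
    intro i
    rw [hM.eigenvalues_eq i]
    set V := hM.eigenvectorBasis i
    have e : V = ∑ j, V j • EuclideanSpace.single j (1 : ℝ) := by
      ext l
      simp [Pi.single_apply]
    have h := fderiv_fderiv_apply_nonpos_of_isLocalMax hφ hmax V
    rw [e] at h
    simp only [map_sum, map_smul, sum_apply, smul_apply, smul_eq_mul] at h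
    refine le_of_eq_of_le ?_ h
    simp only [dotProduct, Matrix.mulVec, hessian, Matrix.of_apply, Pi.star_apply, star_trivial,
      RCLike.re_to_real, Finset.mul_sum]
    rw [Finset.sum_comm]
    refine Finset.sum_congr rfl fun a _ => Finset.sum_congr rfl fun b _ => ?_
    ring_nf
  rw [pucciInf_eq_sum_eigenvalues lam Lam hM,
    Finset.filter_false_of_mem (fun i _ => not_lt.2 (hev i))]
  simp only [Finset.sum_empty, mul_zero, zero_add]
  exact mul_nonpos_of_nonneg_of_nonpos (hlam.le.trans hLam)
    (Finset.sum_nonpos fun i _ => hev i)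

open Filter Topology in
-- A test function touching zero from below has a local maximum, where all eigenvalues of its
-- Hessian are nonpositive.
theorem isViscositySupersolution_of_eq_zero {n : ℕ} {lam Lam : ℝ} (hlam : 0 < lam)
    (hLam : lam ≤ Lam) {g u : EuclideanSpace ℝ (Fin n) → ℝ} {Ω : Set (EuclideanSpace ℝ (Fin n))}
    (hΩ : IsOpen Ω) (hu : ∀ x ∈ Ω, u x = 0) (hg : ∀ x ∈ Ω, g x = 0) :
    IsViscositySupersolution (fun x M => pucciInf lam Lam M + g x) Ω u := by
  refine ⟨continuousOn_const.congr hu, fun x hx φ hφ hmin => ?_⟩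
  have hmax : IsLocalMax φ x := by
    have h : ∀ᶠ y in 𝓝 x, u x - φ x ≤ u y - φ y := by
      have : IsLocalMinOn (fun x => u x - φ x) Ω x := hmin
      rw [IsLocalMinOn, IsMinFilter, hΩ.nhdsWithin_eq hx] at this
      exact this
    filter_upwards [h, hΩ.mem_nhds hx] with y h1 h2
    rw [hu x hx, hu y h2] at h1
    linarith
  have := pucciInf_hessian_nonpos_of_isLocalMax hlam hLam
    (hφ.contDiffAt (hΩ.mem_nhds hx)) hmax
  simpa [hg x hx] using this

theorem mainTheorem6 (n : ℕ) (hn : 2 ≤ n) (lam Lam : ℝ) (hlam : 0 < lam) (hLam : lam ≤ Lam)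
    (p q : ℝ) (hp : 0 < p) (hq : 0 < q)
    (h : (1 < p * q ∧
            (2 * (p + 1) / (p * q - 1) > Lam * (n : ℝ) / lam - 1 ∨
              2 * (q + 1) / (p * q - 1) > Lam * (n : ℝ) / lam - 1)) ∨
          (2 * (p + 1) / (p * q - 1) = Lam * (n : ℝ) / lam - 1 ∧
            2 * (q + 1) / (p * q - 1) = Lam * (n : ℝ) / lam - 1) ∨
          p * q = 1)
    (u v : EuclideanSpace ℝ (Fin n) → ℝ) :
    IsNonnegSystemSupersolution n lam Lam p q u v ↔
      ∀ x ∈ upperHalfSpace n, u x = 0 ∧ v x = 0 := by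
  have hΩ := isOpen_upperHalfSpace n
  constructor
  · rintro ⟨hu0, hv0, hu, hv⟩
    have hvp : ∀ x ∈ upperHalfSpace n, 0 ≤ v x ^ p := fun x hx => Real.rpow_nonneg (hv0 x hx) _
    have huq : ∀ x ∈ upperHalfSpace n, 0 ≤ u x ^ q := fun x hx => Real.rpow_nonneg (hu0 x hx) _
    rcases hu.eq_zero_or_pos (by omega) hlam hLam hu0 hvp with hz | hupos
    · exact fun x hx => ⟨hz x hx,
        (Real.rpow_eq_zero (hv0 x hx) hp.ne').1 (hu.source_eq_zero hΩ hvp hz x hx)⟩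
    rcases hv.eq_zero_or_pos (by omega) hlam hLam hv0 huq with hz | hvpos
    · exact fun x hx => ⟨(Real.rpow_eq_zero (hu0 x hx) hq.ne').1
        (hv.source_eq_zero hΩ huq hz x hx), hz x hx⟩
    exfalso
    rcases h with ⟨hpq, h | h⟩ | ⟨h1, h2⟩ | h
    · exact no_pos_supersolution_of_lt hn hlam hLam hp hq hpq.le
        ((lt_div_iff₀ (by linarith)).1 h) hu hv hupos hvpos
    · refine no_pos_supersolution_of_lt hn hlam hLam hq hp (by linarith) ?_ hv hu hvpos hupos
      rw [mul_comm q p]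
      exact (lt_div_iff₀ (by linarith)).1 h
    · have hγ0 : 0 < Lam * (n : ℝ) / lam - 1 := by
        rw [sub_pos, one_lt_div hlam]
        have : (2 : ℝ) ≤ n := by exact_mod_cast hn
        nlinarith
      -- Division by zero gives `0`, which cannot equal the positive number `Λn/λ - 1`.
      have hne : p * q - 1 ≠ 0 := fun h0 => by
        rw [h0, div_zero] at h1
        linarith
      have hpq : p = q := by
        have := h1.trans h2.symm
        rw [div_left_inj' hne] at this
        linarith
      subst hpq
      refine no_pos_supersolution_of_eq hn hlam hLam hp ?_ hu hv hupos hvpos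
      rw [div_eq_iff hne] at h1
      -- Since `p² - 1 = (p - 1)(p + 1)`, the critical relation reduces to `γ(p - 1) = 2`.
      refine mul_right_cancel₀ (show p + 1 ≠ 0 by linarith) ?_
      linear_combination -h1
    · refine no_pos_supersolution_of_lt hn hlam hLam hp hq h.ge ?_ hu hv hupos hvpos
      rw [h]
      linarith
  · intro h0
    refine ⟨fun x hx => (h0 x hx).1.ge, fun x hx => (h0 x hx).2.ge,
      isViscositySupersolution_of_eq_zero hlam hLam hΩ (fun x hx => (h0 x hx).1) fun x hx => ?_,
      isViscositySupersolution_of_eq_zero hlam hLam hΩ (fun x hx => (h0 x hx).2) fun x hx => ?_⟩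
    · rw [(h0 x hx).2, Real.zero_rpow hp.ne']
    · rw [(h0 x hx).1, Real.zero_rpow hq.ne']
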